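/- Let $\mathcal X\subset\mathbb R^n$ and $\mathcal Y\subset\mathbb R^d$ be nonempty compact convex sets, and let $f:\mathbb R^n\times\mathbb R^d\to\mathbb R$ be continuously differentiable with $$\|\nabla_x f(x,y)-\nabla_x f(x',y')\|\le L(\|x-x'\|+\|y-y'\|),\qquad \|\nabla_y f(x,y)-\nabla_y f(x',y')\|\le \lambda L(\|x-x'\|+\|y-y'\|)$$ for all $x,x'\in\mathcal X$, $y,y'\in\mathcal Y$, where $L,\lambda>0$. For $r_1,r_2\in\mathbb R$ put $$F(x,y,z,v)=f(x,y)+\tfrac{r_1}{2}\|x-z\|^2-\tfrac{r_2}{2}\|y-v\|^2,$$ $d(y,z,v)=\min_{x\in\mathcal X}F(x,y,z,v)$, $p(z,v)=\max_{y\in\mathcal Y}d(y,z,v)$, $q(z)=\max_{v\in\mathbb R^d}p(z,v)$, and $\Phi=F(x,y,z,v)-2d(y,z,v)+2q(z)$. Put $x(y,z,v)=\operatorname{argmin}_{x\in\mathcal X}F(x,y,z,v)$ for $y\in\mathcal Y$, $y(x,z,v)=\operatorname{argmax}_{y\in\mathcal Y}F(x,y,z,v)$ for $x\in\mathcal X$,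 $x(z,v)=\operatorname{argmin}_{x\in\mathcal X}\max_{y\in\mathcal Y}F(x,y,z,v)$, and let $v(z)\in\operatorname{argmax}_{v\in\mathbb R^d}p(z,v)$ be any maximizer. Given parameters $c,\alpha,\beta,\mu$ and a starting point $x^0\in\mathcal X$, $y^0\in\mathcal Y$, $z^0\in\mathbb R^n$, $v^0\in\mathbb R^d$, define for $t\ge 0$ (the Doubly Smoothed GDA algorithm) $$x^{t+1}=\operatorname{proj}_{\mathcal X}\bigl(x^t-c\nabla_xF(x^t,y^t,z^t,v^t)\bigr),\quad y^{t+1}=\operatorname{proj}_{\mathcal Y}\bigl(y^t+\alpha\nabla_yF(x^{t+1},y^t,z^t,v^t)\bigr),$$ $$z^{t+1}=z^t+\beta(x^{t+1}-z^t),\quad v^{t+1}=v^t+\mu(y^{t+1}-v^t),$$ and put $y_+^t(z,v)=\operatorname{proj}_{\mathcal Y}\bigl(y^t+\alpha\nabla_yF(x(y^t,z,v),y^t,z,v)\bigr)$ and $v_+^t(z)=v^t+\mu\bigl(y(x(z,v^t),z,v^t)-v^t\bigr)$. Suppose that $r_1\ge 2L$ and $r_2\ge 2\lambda L$, put $\sigma=\frac{2cr_1+1}{c(r_1-L)}$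 and $L_d=\left(\frac{\lambda L}{r_1-L}+2\right)\lambda L+r_2$, and suppose that $$0<c\le\min\left\{\frac{4}{3(L+r_1)},\frac{1}{6\lambda L}\right\},\qquad 0<\alpha\le\min\left\{\frac{2}{3\lambda L\sigma^2},\frac{1}{6L_d},\frac{1}{5\lambda\sqrt{\lambda+5}\,L}\right\},$$ $$0<\beta\le\min\left\{\frac{24r_1}{360r_1+5r_1^2\lambda+(2\lambda L+5r_1)^2},\frac{\alpha\lambda^2L^2}{384r_1(\lambda+5)(\lambda+1)^2}\right\},$$ $$0<\mu\le\min\left\{\frac{2(\lambda+5)}{2(\lambda+5)+\lambda^2L^2},\frac{\alpha\lambda^2L^2}{64r_2(\lambda+5)}\right\}.$$ Then all the minima and maxima above are attained; the optimizers $x(y,z,v)$ (for $y\in\mathcal Y$), $y(x,z,v)$ (for $x\in\mathcal X$) and $x(z,v)$, and the maximizer of $d(\cdot,z,v)$ over $\mathcal Y$, are unique. With $\Phi^t=\Phi(x^t,y^t,z^t,v^t)$, for every $t\ge0$ and every choice of the maximizer $v(z^{t+1})$, $$\Phi^t-\Phi^{t+1}\ge\frac{r_1}{32}\|x^{t+1}-x^t\|^2+\frac{r_2}{15}\|y^t-y_+^t(z^t,v^t)\|^2+\frac{r_1}{5\beta}\|z^t-z^{t+1}\|^2+\frac{r_2}{4\mu}\|v_+^t(z^{t+1})-v^t\|^2$$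 $$\qquad-4r_1\beta\bigl\|x(z^{t+1},v(z^{t+1}))-x(z^{t+1},v_+^t(z^{t+1}))\bigr\|^2.$$ -/

import Mathlib

open Set

namespace DSGDA

noncomputable section

variable {E G : Type*} [NormedAddCommGroup E] [InnerProductSpace ℝ E] [CompleteSpace E]
  [NormedAddCommGroup G] [InnerProductSpace ℝ G] [CompleteSpace G]

/-- A minimizer of `φ` over `S` (a choice of one if there are several, and an arbitrary point if
there is none). -/
def argminOn {A : Type*} [Nonempty A] (φ : A → ℝ) (S : Set A) : A :=
  Classical.epsilon fun a => a ∈ S ∧ IsMinOn φ S a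

/-- A maximizer of `φ` over `S` (a choice of one if there are several, and an arbitrary point if
there is none). -/
def argmaxOn {A : Type*} [Nonempty A] (φ : A → ℝ) (S : Set A) : A :=
  Classical.epsilon fun a => a ∈ S ∧ IsMaxOn φ S a

/-- The Euclidean projection of `u` onto `S`: the point of `S` closest to `u`. -/
def proj (S : Set E) (u : E) : E := argminOn (fun w => ‖u - w‖) S

/-- The data of the smoothed minimax problem: the objective `f`, the two constraint sets and the
two smoothing parameters. -/
structure Data (E G : Type*) where
  /-- objective function -/
  f : E → G → ℝ
  /-- primal constraint set -/
  X : Set E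
  /-- dual constraint set -/
  Y : Set G
  /-- primal smoothing parameter -/
  r₁ : ℝ
  /-- dual smoothing parameter -/
  r₂ : ℝ

namespace Data

variable (P : Data E G)

/-- `F(x,y,z,v) = f(x,y) + (r₁/2)‖x - z‖² - (r₂/2)‖y - v‖²`. -/
def F (x : E) (y : G) (z : E) (v : G) : ℝ :=
  P.f x y + P.r₁ / 2 * ‖x - z‖ ^ 2 - P.r₂ / 2 * ‖y - v‖ ^ 2

/-- The partial gradient `∇ₓF(x,y,z,v)`. -/
def gradXF (x : E) (y : G) (z : E) (v : G) : E := gradient (fun x' => P.F x' y z v) x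

/-- The partial gradient `∇_yF(x,y,z,v)`. -/
def gradYF (x : E) (y : G) (z : E) (v : G) : G := gradient (fun y' => P.F x y' z v) y

/-- `d(y,z,v) = min_{x ∈ X} F(x,y,z,v)`. -/
def d (y : G) (z : E) (v : G) : ℝ := sInf ((fun x => P.F x y z v) '' P.X)

/-- `h(x,z,v) = max_{y ∈ Y} F(x,y,z,v)`. -/
def h (x : E) (z : E) (v : G) : ℝ := sSup ((fun y => P.F x y z v) '' P.Y)

/-- `p(z,v) = max_{y ∈ Y} d(y,z,v)`. -/
def p (z : E) (v : G) : ℝ := sSup ((fun y => P.d y z v) '' P.Y)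

/-- `q(z) = max_v p(z,v)`, the maximum being over the whole space. -/
def q (z : E) : ℝ := sSup (range fun v => P.p z v)

/-- The Lyapunov function `Φ = F - 2d + 2q`. -/
def Φ (x : E) (y : G) (z : E) (v : G) : ℝ := P.F x y z v - 2 * P.d y z v + 2 * P.q z

/-- `x(y,z,v) = argmin_{x ∈ X} F(x,y,z,v)`. -/
def xOf (y : G) (z : E) (v : G) : E := argminOn (fun x => P.F x y z v) P.X

/-- `y(x,z,v) = argmax_{y ∈ Y} F(x,y,z,v)`. -/
def yOf (x : E) (z : E) (v : G) : G := argmaxOn (fun y => P.F x y z v) P.Y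

/-- `x(z,v) = argmin_{x ∈ X} max_{y ∈ Y} F(x,y,z,v)`. -/
def xStar (z : E) (v : G) : E := argminOn (fun x => P.h x z v) P.X

/-- `y₊(z,v) = proj_Y (y + α ∇_yF(x(y,z,v),y,z,v))`. -/
def yPlus (α : ℝ) (y : G) (z : E) (v : G) : G :=
  proj P.Y (y + α • P.gradYF (P.xOf y z v) y z v)

/-- `v₊(z) = v + μ (y(x(z,v),z,v) - v)`. -/
def vPlus (μ : ℝ) (v : G) (z : E) : G := v + μ • (P.yOf (P.xStar z v) z v - v)

/-- The function `f` is continuously differentiable and, on `X × Y`, its partial gradients satisfy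
the Lipschitz bounds with constants `L` (in `x`) and `lam * L` (in `y`). -/
def SmoothObjective (L lam : ℝ) : Prop :=
  ContDiff ℝ 1 (fun w : E × G => P.f w.1 w.2) ∧
  ∀ x ∈ P.X, ∀ x' ∈ P.X, ∀ y ∈ P.Y, ∀ y' ∈ P.Y,
    ‖gradient (fun u => P.f u y) x - gradient (fun u => P.f u y') x'‖
        ≤ L * (‖x - x'‖ + ‖y - y'‖) ∧
    ‖gradient (fun u => P.f x u) y - gradient (fun u => P.f x' u) y'‖
        ≤ lam * L * (‖x - x'‖ + ‖y - y'‖)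

/-- The sequence `(x^t, y^t, z^t, v^t)` is generated by doubly smoothed gradient descent ascent,
started at a point with `x^0 ∈ X` and `y^0 ∈ Y`. -/
structure IsDSGDA (c α β μ : ℝ) (x : ℕ → E) (y : ℕ → G) (z : ℕ → E) (v : ℕ → G) : Prop where
  x_zero : x 0 ∈ P.X
  y_zero : y 0 ∈ P.Y
  x_succ : ∀ t, x (t + 1) = proj P.X (x t - c • P.gradXF (x t) (y t) (z t) (v t))
  y_succ : ∀ t, y (t + 1) = proj P.Y (y t + α • P.gradYF (x (t + 1)) (y t) (z t) (v t))
  z_succ : ∀ t, z (t + 1) = z t + β • (x (t + 1) - z t)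
  v_succ : ∀ t, v (t + 1) = v t + μ • (y (t + 1) - v t)

/-- The constant `σ = (2 c r₁ + 1) / (c (r₁ - L))`. -/
def σ (L c : ℝ) : ℝ := (2 * c * P.r₁ + 1) / (c * (P.r₁ - L))

/-- The constant `L_d = (λL / (r₁ - L) + 2) λL + r₂`. -/
def Ld (L lam : ℝ) : ℝ := (lam * L / (P.r₁ - L) + 2) * (lam * L) + P.r₂

end Data

end

end DSGDA

namespace DSGDA

open scoped RealInnerProductSpace Gradient Topology

/-! ### Projections and smooth functions on compact convex sets. -/

section Generic

variable {V : Type*} [NormedAddCommGroup V]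

/-! Since `r₁ ≥ 2L` and `r₂ ≥ 2λL`, the proximal terms dominate the curvature of `f`: on `X × Y`,
`F` is strongly convex in `x` and strongly concave in `y`. This gives unique optimizers, saddle
points (`isSaddle_of_isMaxOn_d`) and their Lipschitz dependence on the centres `z, v`
(`perturbation`).

Write primes for the next iterates. The decrease of `Φ` splits into the gradient steps with centres
frozen (`gradient_steps_ge`), the exactly computable changes of `F` and `d` due to the centres, and
the pair `2(d(y',z',v) - d(y',z,v)) + 2(q(z) - q(z'))`. The gradient steps earn multiples of `‖x' -
x‖²` and `‖y - y₊‖²`; the explicit changes earn multiples of `‖x' - z‖²` and `‖y' - v‖²`.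

The last pair can be negative. The two increments nearly cancel: together they are at least `-2 r₁
‖z - z'‖` times the distance from `x(z, v(z'))` to `x(y', z', v)`. A chain of triangle inequalities
bounds this distance by quantities already controlled, except for the residual `‖x(z',v(z')) -
x(z',v₊)‖`, which survives in the conclusion. Young's inequality and the smallness of `β` and `μ`
absorb the rest (`descent_arithmetic`). -/

theorem argminOn_spec {A : Type*} [TopologicalSpace A] [Nonempty A] {φ : A → ℝ} {S : Set A}
    (hS : IsCompact S) (hne : S.Nonempty) (hφ : ContinuousOn φ S) :
    argminOn φ S ∈ S ∧ IsMinOn φ S (argminOn φ S) := by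
  obtain ⟨a, ha, hmin⟩ := hS.exists_isMinOn hne hφ
  exact Classical.epsilon_spec (p := fun a => a ∈ S ∧ IsMinOn φ S a) ⟨a, ha, hmin⟩

theorem argmaxOn_spec {A : Type*} [TopologicalSpace A] [Nonempty A] {φ : A → ℝ} {S : Set A}
    (hS : IsCompact S) (hne : S.Nonempty) (hφ : ContinuousOn φ S) :
    argmaxOn φ S ∈ S ∧ IsMaxOn φ S (argmaxOn φ S) := by
  obtain ⟨a, ha, hmax⟩ := hS.exists_isMaxOn hne hφ
  exact Classical.epsilon_spec (p := fun a => a ∈ S ∧ IsMaxOn φ S a) ⟨a, ha, hmax⟩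

theorem proj_mem {K : Set V} (hK : IsCompact K) (hne : K.Nonempty) (u : V) : proj K u ∈ K :=
  (argminOn_spec (φ := fun w => ‖u - w‖) hK hne (by fun_prop)).1

variable [InnerProductSpace ℝ V]

theorem inner_sub_proj_nonpos {K : Set V} (hK : IsCompact K) (hne : K.Nonempty)
    (hconv : Convex ℝ K) (u : V) {k : V} (hk : k ∈ K) : ⟪u - proj K u, k - proj K u⟫ ≤ 0 := by
  have h := argminOn_spec (φ := fun w => ‖u - w‖) hK hne (by fun_prop)
  change proj K u ∈ K ∧ IsMinOn _ K (proj K u) at h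
  refine (norm_eq_iInf_iff_real_inner_le_zero hconv h.1).1 ?_ k hk
  have : Nonempty K := ⟨⟨_, h.1⟩⟩
  refine le_antisymm (le_ciInf fun w => h.2 w.2) ?_
  exact ciInf_le (f := fun w : K => ‖u - w‖) ⟨0, by rintro _ ⟨w, rfl⟩; positivity⟩ ⟨_, h.1⟩

/-- The projected step `proj (x - c g)` satisfies `⟪g, x⁺ - k⟫ ≤ ⟪x - x⁺, x⁺ - k⟫ / c`. -/
theorem inner_projected_step {K : Set V} (hK : IsCompact K) (hne : K.Nonempty)
    (hconv : Convex ℝ K) (x g : V) (c : ℝ) {k : V} (hk : k ∈ K) :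
    c * ⟪g, proj K (x - c • g) - k⟫ ≤ ⟪x - proj K (x - c • g), proj K (x - c • g) - k⟫ := by
  have h := inner_sub_proj_nonpos hK hne hconv (x - c • g) hk
  set w := proj K (x - c • g)
  have e : ⟪x - c • g - w, k - w⟫ = c * ⟪g, w - k⟫ - ⟪x - w, w - k⟫ := by
    rw [show x - c • g - w = (x - w) - c • g by abel, ← neg_sub w k, inner_neg_right,
      inner_sub_left, real_inner_smul_left]
    ring
  linarith

theorem norm_proj_sub_proj_le {K : Set V} (hK : IsCompact K) (hne : K.Nonempty)
    (hconv : Convex ℝ K) (u w : V) : ‖proj K u - proj K w‖ ≤ ‖u - w‖ := by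
  have h1 := inner_sub_proj_nonpos hK hne hconv u (proj_mem hK hne w)
  have h2 := inner_sub_proj_nonpos hK hne hconv w (proj_mem hK hne u)
  set a := proj K u
  set b := proj K w
  have e : ⟪a - b, a - b⟫ = ⟪u - a, b - a⟫ + ⟪w - b, a - b⟫ + ⟪u - w, a - b⟫ := by
    rw [← neg_sub a b, inner_neg_right]
    simp only [inner_sub_left]
    ring
  rw [real_inner_self_eq_norm_sq] at e
  have h3 := real_inner_le_norm (u - w) (a - b)
  by_contra! hlt
  nlinarith [norm_nonneg (a - b), norm_nonneg (u - w)]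

/-- Error bound for a projected gradient step on a function with quadratic lower and upper
bounds of moduli `s` and `M`. -/
theorem projected_step_error {K : Set V} (hK : IsCompact K) (hne : K.Nonempty)
    (hconv : Convex ℝ K) {x g p : V} {c s M φx φw φp : ℝ} (hp : p ∈ K) (hc : 0 < c) (hs : 0 < s)
    (hM : c * M ≤ 2)
    (hlow : φx + ⟪g, p - x⟫ + s / 2 * ‖p - x‖ ^ 2 ≤ φp)
    (hup : φw ≤ φx + ⟪g, proj K (x - c • g) - x⟫ + M / 2 * ‖proj K (x - c • g) - x‖ ^ 2)
    (hgrow : φp + s / 2 * ‖proj K (x - c • g) - p‖ ^ 2 ≤ φw) :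
    ‖proj K (x - c • g) - p‖ ≤ ‖proj K (x - c • g) - x‖ / (c * s) := by
  have h := inner_projected_step hK hne hconv x g c hp
  set w := proj K (x - c • g)
  have e1 : ⟪g, w - p⟫ = ⟪g, w - x⟫ - ⟪g, p - x⟫ := by
    rw [← inner_sub_right]; congr 1; abel
  have e2 : ⟪x - w, w - p⟫ = ⟪w - x, p - x⟫ - ‖w - x‖ ^ 2 := by
    rw [← real_inner_self_eq_norm_sq, ← inner_sub_right, ← neg_sub w x, inner_neg_left,
      ← inner_neg_right]; congr 1; abel
  have h3 := real_inner_le_norm (w - x) (p - x)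
  rw [le_div_iff₀ (by positivity)]
  set A := ‖w - p‖
  set B := ‖p - x‖
  set a := ‖w - x‖
  have hA : 0 ≤ A := norm_nonneg _
  have ha : 0 ≤ a := norm_nonneg _
  -- The three function bounds telescope to an upper bound by `⟪g, w - p⟫ + M / 2 * a ^ 2`; the
  -- projection inequality contributes `-a ^ 2`, which cancels the `M` term because `c * M ≤ 2`.
  have key : c * (s / 2 * (A ^ 2 + B ^ 2)) ≤ a * B := by
    have h4 : s / 2 * (A ^ 2 + B ^ 2) ≤ ⟪g, w - p⟫ + M / 2 * a ^ 2 := by linarith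
    have h5 := mul_le_mul_of_nonneg_left h4 hc.le
    nlinarith [mul_le_mul_of_nonneg_right hM (sq_nonneg a)]
  have hcs : 0 < c * s := by positivity
  have : (A * (c * s)) ^ 2 ≤ a ^ 2 := by
    nlinarith [sq_nonneg (c * s * B - a), mul_le_mul_of_nonneg_left key hcs.le]
  exact abs_le_of_sq_le_sq' this ha |>.2

variable [CompleteSpace V]

/-- The gradient is Lipschitz only on `K`, so the Taylor remainder is followed along the segment
from `x` to `u`, where its derivative is at most `M * ‖u - x‖ ^ 2 * τ`. The lower half replaces
convexity, which `f` need not have. -/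
theorem abs_sub_sub_inner_gradient_le {K : Set V} (hconv : Convex ℝ K) {φ : V → ℝ}
    (hφ : Differentiable ℝ φ) {M : ℝ}
    (hM : ∀ a ∈ K, ∀ b ∈ K, ‖∇ φ a - ∇ φ b‖ ≤ M * ‖a - b‖) {x u : V} (hx : x ∈ K) (hu : u ∈ K) :
    |φ u - φ x - ⟪∇ φ x, u - x⟫| ≤ M / 2 * ‖u - x‖ ^ 2 := by
  let γ : ℝ → V := fun τ => x + τ • (u - x)
  have hγ : ∀ τ, HasDerivAt γ (u - x) τ := fun τ =>
    (((hasDerivAt_id τ).smul_const (u - x)).const_add x).congr_deriv (one_smul ℝ _)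
  let ψ : ℝ → ℝ := fun τ => φ (γ τ) - φ x - τ * ⟪∇ φ x, u - x⟫
  have hψ : ∀ τ, HasDerivAt ψ (⟪∇ φ (γ τ) - ∇ φ x, u - x⟫) τ := fun τ => by
    have h1 : HasDerivAt (fun τ => φ (γ τ)) (⟪∇ φ (γ τ), u - x⟫) τ := by
      rw [inner_gradient_left]
      exact (hφ (γ τ)).hasFDerivAt.comp_hasDerivAt τ (hγ τ)
    have h2 := (h1.sub_const (φ x)).sub ((hasDerivAt_id τ).mul_const (⟪∇ φ x, u - x⟫))
    exact h2.congr_deriv (by rw [inner_sub_left, one_mul])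
  have hB : ∀ τ : ℝ, HasDerivAt (fun τ : ℝ => M / 2 * ‖u - x‖ ^ 2 * τ ^ 2)
      (M * ‖u - x‖ ^ 2 * τ) τ := fun τ => by
    have := (hasDerivAt_pow 2 τ).const_mul (M / 2 * ‖u - x‖ ^ 2)
    refine this.congr_deriv ?_
    push_cast; ring
  have hmain := image_norm_le_of_norm_deriv_right_le_deriv_boundary' (f := ψ) (a := 0) (b := 1)
    (fun τ _ => (hψ τ).continuousAt.continuousWithinAt) (fun τ _ => (hψ τ).hasDerivWithinAt)
    (B := fun τ : ℝ => M / 2 * ‖u - x‖ ^ 2 * τ ^ 2) (by simp [ψ, γ])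
    (fun τ _ => (hB τ).continuousAt.continuousWithinAt) (fun τ _ => (hB τ).hasDerivWithinAt)
    (fun τ hτ => by
      have hγK : γ τ ∈ K := hconv.add_smul_sub_mem hx hu ⟨hτ.1, hτ.2.le⟩
      calc ‖⟪∇ φ (γ τ) - ∇ φ x, u - x⟫‖ ≤ ‖∇ φ (γ τ) - ∇ φ x‖ * ‖u - x‖ := norm_inner_le_norm _ _
        _ ≤ M * ‖γ τ - x‖ * ‖u - x‖ := by gcongr; exact hM _ hγK _ hx
        _ = M * ‖u - x‖ ^ 2 * τ := by
            have : ‖γ τ - x‖ = τ * ‖u - x‖ := by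
              simp [γ, norm_smul, abs_of_nonneg hτ.1]
            rw [this]; ring)
    (right_mem_Icc.2 zero_le_one)
  simpa [ψ, γ, Real.norm_eq_abs] using hmain

theorem inner_gradient_nonneg_of_isMinOn {K : Set V} (hconv : Convex ℝ K) {φ : V → ℝ}
    (hφ : Differentiable ℝ φ) {x u : V} (hx : x ∈ K) (hu : u ∈ K) (hmin : IsMinOn φ K x) :
    0 ≤ ⟪∇ φ x, u - x⟫ := by
  rw [inner_gradient_left]
  exact hmin.localize.hasFDerivWithinAt_nonneg (hφ x).hasFDerivAt.hasFDerivWithinAt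
    (sub_mem_posTangentConeAt_of_segment_subset (hconv.segment_subset hx hu))

theorem abs_sub_le_of_gradient_le {K : Set V} (hconv : Convex ℝ K) {φ : V → ℝ}
    (hφ : Differentiable ℝ φ) {C : ℝ} (hC : ∀ a ∈ K, ‖∇ φ a‖ ≤ C) {x u : V} (hx : x ∈ K)
    (hu : u ∈ K) : |φ u - φ x| ≤ C * ‖u - x‖ := by
  refine hconv.norm_image_sub_le_of_norm_hasFDerivWithin_le (𝕜 := ℝ)
    (fun a _ => (hφ a).hasFDerivAt.hasFDerivWithinAt) (fun a ha => ?_) hx hu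
  rw [← toDual_gradient, LinearIsometryEquiv.norm_map]
  exact hC a ha

theorem hasGradientAt_const_mul_norm_sub_sq (r : ℝ) (z x : V) :
    HasGradientAt (fun u => r / 2 * ‖u - z‖ ^ 2) (r • (x - z)) x := by
  rw [hasGradientAt_iff_hasFDerivAt]
  have h := (((hasFDerivAt_id x).sub_const z).norm_sq).const_mul (r / 2)
  refine h.congr_fderiv ?_
  ext w
  simp
  ring

end Generic

variable {E G : Type*} [NormedAddCommGroup E] [InnerProductSpace ℝ E] [CompleteSpace E]
  [NormedAddCommGroup G] [InnerProductSpace ℝ G] [CompleteSpace G]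

/-! ### Curvature bounds for `F` and for the dual function `d`. -/

namespace Data

/-- The standing assumptions on the smoothed minimax problem. -/
structure Regular (P : Data E G) (L lam : ℝ) : Prop where
  compact_X : IsCompact P.X
  convex_X : Convex ℝ P.X
  nonempty_X : P.X.Nonempty
  compact_Y : IsCompact P.Y
  convex_Y : Convex ℝ P.Y
  nonempty_Y : P.Y.Nonempty
  L_pos : 0 < L
  lam_pos : 0 < lam
  smooth : P.SmoothObjective L lam
  le_r₁ : 2 * L ≤ P.r₁
  le_r₂ : 2 * lam * L ≤ P.r₂

namespace Regular

variable {P : Data E G} {L lam : ℝ} (hP : P.Regular L lam)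

include hP

theorem lamL_pos : 0 < lam * L := mul_pos hP.lam_pos hP.L_pos

theorem r₁_sub_pos : 0 < P.r₁ - L := by linarith [hP.L_pos, hP.le_r₁]

theorem r₂_sub_pos : 0 < P.r₂ - lam * L := by linarith [hP.lamL_pos, hP.le_r₂]

theorem continuous_f : Continuous fun w : E × G => P.f w.1 w.2 := hP.smooth.1.continuous

theorem continuous_F : Continuous fun w : (E × G) × E × G => P.F w.1.1 w.1.2 w.2.1 w.2.2 := by
  have := hP.continuous_f.comp (continuous_fst (X := E × G) (Y := E × G))
  unfold F
  fun_prop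

theorem differentiable_f_left (y : G) : Differentiable ℝ fun x => P.f x y := fun x =>
  DifferentiableAt.comp (g := fun w : E × G => P.f w.1 w.2) (f := fun x => (x, y)) x
    ((hP.smooth.1.differentiable one_ne_zero) (x, y))
    (differentiableAt_id.prodMk (differentiableAt_const y))

theorem differentiable_f_right (x : E) : Differentiable ℝ fun y => P.f x y := fun y =>
  DifferentiableAt.comp (g := fun w : E × G => P.f w.1 w.2) (f := fun y => (x, y)) y
    ((hP.smooth.1.differentiable one_ne_zero) (x, y))
    ((differentiableAt_const x).prodMk differentiableAt_id)

theorem hasGradientAt_F_left (x : E) (y : G) (z : E) (v : G) :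
    HasGradientAt (fun x => P.F x y z v) (∇ (fun u => P.f u y) x + P.r₁ • (x - z)) x := by
  have h1 := (hP.differentiable_f_left y x).hasGradientAt.hasFDerivAt
  have h2 := (hasGradientAt_const_mul_norm_sub_sq P.r₁ z x).hasFDerivAt
  rw [hasGradientAt_iff_hasFDerivAt, map_add]
  exact (h1.add h2).sub_const _

theorem hasGradientAt_F_right (x : E) (y : G) (z : E) (v : G) :
    HasGradientAt (fun y => P.F x y z v) (∇ (fun u => P.f x u) y - P.r₂ • (y - v)) y := by
  have h1 := (hP.differentiable_f_right x y).hasGradientAt.hasFDerivAt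
  have h2 := (hasGradientAt_const_mul_norm_sub_sq P.r₂ v y).hasFDerivAt
  rw [hasGradientAt_iff_hasFDerivAt, map_sub]
  exact (h1.add_const _).sub h2

theorem gradXF_eq (x : E) (y : G) (z : E) (v : G) :
    P.gradXF x y z v = ∇ (fun u => P.f u y) x + P.r₁ • (x - z) :=
  (hP.hasGradientAt_F_left x y z v).gradient

theorem gradYF_eq (x : E) (y : G) (z : E) (v : G) :
    P.gradYF x y z v = ∇ (fun u => P.f x u) y - P.r₂ • (y - v) :=
  (hP.hasGradientAt_F_right x y z v).gradient

theorem differentiable_F_left (y : G) (z : E) (v : G) : Differentiable ℝ fun x => P.F x y z v :=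
  fun x => (hP.hasGradientAt_F_left x y z v).differentiableAt

theorem differentiable_F_right (x : E) (z : E) (v : G) : Differentiable ℝ fun y => P.F x y z v :=
  fun y => (hP.hasGradientAt_F_right x y z v).differentiableAt

/-- The second-order expansion of the proximal term is exact, so the error comes from `f` alone.
This yields the moduli `r₁ - L` and `r₁ + L` below. -/
theorem abs_F_left_sub_le {x u : E} {y : G} (hx : x ∈ P.X) (hu : u ∈ P.X) (hy : y ∈ P.Y)
    (z : E) (v : G) :
    |P.F u y z v - P.F x y z v - ⟪P.gradXF x y z v, u - x⟫ - P.r₁ / 2 * ‖u - x‖ ^ 2|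
      ≤ L / 2 * ‖u - x‖ ^ 2 := by
  have h := abs_sub_sub_inner_gradient_le hP.convex_X (hP.differentiable_f_left y) (M := L)
    (fun a ha b hb => by simpa using (hP.smooth.2 a ha b hb y hy y hy).1) hx hu
  convert h using 2
  rw [hP.gradXF_eq, inner_add_left, real_inner_smul_left]
  have e : ‖u - z‖ ^ 2 = ‖u - x‖ ^ 2 + 2 * ⟪u - x, x - z⟫ + ‖x - z‖ ^ 2 := by
    rw [← norm_add_sq_real, sub_add_sub_cancel]
  rw [F, F, e, real_inner_comm (x - z)]
  ring

theorem abs_F_right_sub_le {x : E} {y u : G} (hx : x ∈ P.X) (hy : y ∈ P.Y) (hu : u ∈ P.Y)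
    (z : E) (v : G) :
    |P.F x u z v - P.F x y z v - ⟪P.gradYF x y z v, u - y⟫ + P.r₂ / 2 * ‖u - y‖ ^ 2|
      ≤ lam * L / 2 * ‖u - y‖ ^ 2 := by
  have h := abs_sub_sub_inner_gradient_le hP.convex_Y (hP.differentiable_f_right x) (M := lam * L)
    (fun a ha b hb => by simpa using (hP.smooth.2 x hx x hx a ha b hb).2) hy hu
  convert h using 2
  rw [hP.gradYF_eq, inner_sub_left, real_inner_smul_left]
  have e : ‖u - v‖ ^ 2 = ‖u - y‖ ^ 2 + 2 * ⟪u - y, y - v⟫ + ‖y - v‖ ^ 2 := by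
    rw [← norm_add_sq_real, sub_add_sub_cancel]
  rw [F, F, e, real_inner_comm (y - v)]
  ring

theorem F_left_lower {x u : E} {y : G} (hx : x ∈ P.X) (hu : u ∈ P.X) (hy : y ∈ P.Y)
    (z : E) (v : G) :
    P.F x y z v + ⟪P.gradXF x y z v, u - x⟫ + (P.r₁ - L) / 2 * ‖u - x‖ ^ 2 ≤ P.F u y z v := by
  linarith [(abs_le.1 (hP.abs_F_left_sub_le hx hu hy z v)).1]

theorem F_left_upper {x u : E} {y : G} (hx : x ∈ P.X) (hu : u ∈ P.X) (hy : y ∈ P.Y)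
    (z : E) (v : G) :
    P.F u y z v ≤ P.F x y z v + ⟪P.gradXF x y z v, u - x⟫ + (L + P.r₁) / 2 * ‖u - x‖ ^ 2 := by
  linarith [(abs_le.1 (hP.abs_F_left_sub_le hx hu hy z v)).2]

theorem F_right_lower {x : E} {y u : G} (hx : x ∈ P.X) (hy : y ∈ P.Y) (hu : u ∈ P.Y)
    (z : E) (v : G) :
    P.F x y z v + ⟪P.gradYF x y z v, u - y⟫ - (lam * L + P.r₂) / 2 * ‖u - y‖ ^ 2
      ≤ P.F x u z v := by
  linarith [(abs_le.1 (hP.abs_F_right_sub_le hx hy hu z v)).1]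

theorem F_right_upper {x : E} {y u : G} (hx : x ∈ P.X) (hy : y ∈ P.Y) (hu : u ∈ P.Y)
    (z : E) (v : G) :
    P.F x u z v
      ≤ P.F x y z v + ⟪P.gradYF x y z v, u - y⟫ - (P.r₂ - lam * L) / 2 * ‖u - y‖ ^ 2 := by
  linarith [(abs_le.1 (hP.abs_F_right_sub_le hx hy hu z v)).2]

theorem norm_gradYF_sub_le {x x' : E} {y : G} (hx : x ∈ P.X) (hx' : x' ∈ P.X) (hy : y ∈ P.Y)
    (z : E) (v : G) :
    ‖P.gradYF x y z v - P.gradYF x' y z v‖ ≤ lam * L * ‖x - x'‖ := by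
  rw [hP.gradYF_eq, hP.gradYF_eq, sub_sub_sub_cancel_right]
  simpa using (hP.smooth.2 x hx x' hx' y hy y hy).2

/-- Mixed second difference of `F`. -/
theorem abs_F_mixed_sub_le {x x' : E} {y y' : G} (hx : x ∈ P.X) (hx' : x' ∈ P.X) (hy : y ∈ P.Y)
    (hy' : y' ∈ P.Y) (z : E) (v : G) :
    |(P.F x' y z v - P.F x' y' z v) - (P.F x y z v - P.F x y' z v)|
      ≤ L * ‖y - y'‖ * ‖x' - x‖ := by
  -- The proximal terms drop out of the mixed difference; what is left is the variation of `f(·,y) -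
  -- f(·,y')`, whose gradient on `X` is at most `L * ‖y - y'‖`.
  have hd : Differentiable ℝ fun u => P.f u y - P.f u y' :=
    (hP.differentiable_f_left y).sub (hP.differentiable_f_left y')
  have h := abs_sub_le_of_gradient_le hP.convex_X hd (C := L * ‖y - y'‖) (fun a ha => ?_) hx hx'
  · convert h using 2
    simp only [F]
    ring
  · have hg : ∇ (fun u => P.f u y - P.f u y') a
        = ∇ (fun u => P.f u y) a - ∇ (fun u => P.f u y') a := by
      refine HasGradientAt.gradient ?_
      rw [hasGradientAt_iff_hasFDerivAt, map_sub]
      exact (hP.differentiable_f_left y a).hasGradientAt.hasFDerivAt.sub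
        (hP.differentiable_f_left y' a).hasGradientAt.hasFDerivAt
    rw [hg]
    simpa using (hP.smooth.2 a ha a ha y hy y' hy').1

theorem F_growth_of_isMinOn {x u : E} {y : G} {z : E} {v : G} (hx : x ∈ P.X) (hu : u ∈ P.X)
    (hy : y ∈ P.Y) (hmin : IsMinOn (fun x => P.F x y z v) P.X x) :
    P.F x y z v + (P.r₁ - L) / 2 * ‖u - x‖ ^ 2 ≤ P.F u y z v := by
  have h1 := inner_gradient_nonneg_of_isMinOn hP.convex_X (hP.differentiable_F_left y z v) hx hu
    hmin
  have h2 := hP.F_left_lower hx hu hy z v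
  rw [gradXF] at h2
  linarith

theorem F_growth_of_isMaxOn {x : E} {y u : G} {z : E} {v : G} (hx : x ∈ P.X) (hy : y ∈ P.Y)
    (hu : u ∈ P.Y) (hmax : IsMaxOn (fun y => P.F x y z v) P.Y y) :
    P.F x u z v ≤ P.F x y z v - (P.r₂ - lam * L) / 2 * ‖u - y‖ ^ 2 := by
  have h1 := inner_gradient_nonneg_of_isMinOn hP.convex_Y (hP.differentiable_F_right x z v).neg
    hy hu hmax.neg
  have hg : ∇ (-fun y => P.F x y z v) y = -P.gradYF x y z v := by
    refine HasGradientAt.gradient ?_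
    rw [hasGradientAt_iff_hasFDerivAt, map_neg]
    exact (hP.differentiable_F_right x z v y).hasGradientAt.hasFDerivAt.neg
  rw [hg, inner_neg_left] at h1
  have h2 := hP.F_right_upper hx hy hu z v
  linarith

theorem continuous_F_left (y : G) (z : E) (v : G) : Continuous fun x => P.F x y z v :=
  (hP.differentiable_F_left y z v).continuous

theorem continuous_F_right (x : E) (z : E) (v : G) : Continuous fun y => P.F x y z v :=
  (hP.differentiable_F_right x z v).continuous

theorem xOf_mem (y : G) (z : E) (v : G) : P.xOf y z v ∈ P.X :=
  (argminOn_spec hP.compact_X hP.nonempty_X (hP.continuous_F_left y z v).continuousOn).1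

theorem isMinOn_xOf (y : G) (z : E) (v : G) :
    IsMinOn (fun x => P.F x y z v) P.X (P.xOf y z v) :=
  (argminOn_spec hP.compact_X hP.nonempty_X (hP.continuous_F_left y z v).continuousOn).2

theorem yOf_mem (x : E) (z : E) (v : G) : P.yOf x z v ∈ P.Y :=
  (argmaxOn_spec hP.compact_Y hP.nonempty_Y (hP.continuous_F_right x z v).continuousOn).1

theorem isMaxOn_yOf (x : E) (z : E) (v : G) :
    IsMaxOn (fun y => P.F x y z v) P.Y (P.yOf x z v) :=
  (argmaxOn_spec hP.compact_Y hP.nonempty_Y (hP.continuous_F_right x z v).continuousOn).2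

theorem F_xOf_growth {u : E} {y : G} (hu : u ∈ P.X) (hy : y ∈ P.Y) (z : E) (v : G) :
    P.F (P.xOf y z v) y z v + (P.r₁ - L) / 2 * ‖u - P.xOf y z v‖ ^ 2 ≤ P.F u y z v :=
  hP.F_growth_of_isMinOn (hP.xOf_mem y z v) hu hy (hP.isMinOn_xOf y z v)

theorem d_eq (y : G) (z : E) (v : G) : P.d y z v = P.F (P.xOf y z v) y z v := by
  refine IsLeast.csInf_eq ⟨mem_image_of_mem _ (hP.xOf_mem y z v), ?_⟩
  rintro _ ⟨x, hx, rfl⟩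
  exact hP.isMinOn_xOf y z v hx

theorem d_le {x : E} (hx : x ∈ P.X) (y : G) (z : E) (v : G) : P.d y z v ≤ P.F x y z v := by
  rw [hP.d_eq]
  exact hP.isMinOn_xOf y z v hx

theorem h_eq (x : E) (z : E) (v : G) : P.h x z v = P.F x (P.yOf x z v) z v := by
  refine IsGreatest.csSup_eq ⟨mem_image_of_mem _ (hP.yOf_mem x z v), ?_⟩
  rintro _ ⟨y, hy, rfl⟩
  exact hP.isMaxOn_yOf x z v hy

theorem le_h {y : G} (hy : y ∈ P.Y) (x : E) (z : E) (v : G) : P.F x y z v ≤ P.h x z v := by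
  rw [hP.h_eq]
  exact hP.isMaxOn_yOf x z v hy

theorem continuous_d : Continuous fun w : G × E × G => P.d w.1 w.2.1 w.2.2 := by
  unfold d
  refine hP.compact_X.continuous_sInf (f := fun (w : G × E × G) x => P.F x w.1 w.2.1 w.2.2) ?_
  exact hP.continuous_F.comp (f := fun q : (G × E × G) × E => ((q.2, q.1.1), q.1.2.1, q.1.2.2))
    (by fun_prop)

theorem continuous_d_left (z : E) (v : G) : Continuous fun y => P.d y z v :=
  hP.continuous_d.comp (f := fun y : G => (y, z, v)) (by fun_prop)

theorem continuous_d_diag (z : E) : Continuous fun y => P.d y z y :=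
  hP.continuous_d.comp (f := fun y : G => (y, z, y)) (by fun_prop)

theorem isMinOn_xOf_unique {x : E} {y : G} {z : E} {v : G} (hx : x ∈ P.X) (hy : y ∈ P.Y)
    (hmin : IsMinOn (fun x => P.F x y z v) P.X x) : x = P.xOf y z v := by
  have h1 := hP.F_xOf_growth hx hy z v
  have h2 := hmin (hP.xOf_mem y z v)
  simp only [mem_ofPred_eq] at h2
  have h3 := hP.r₁_sub_pos
  have h4 : ‖x - P.xOf y z v‖ ^ 2 ≤ 0 := by
    by_contra! h
    nlinarith
  exact sub_eq_zero.1 (norm_eq_zero.1 (by nlinarith [norm_nonneg (x - P.xOf y z v)]))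

theorem isMaxOn_F_unique {x : E} {y y' : G} {z : E} {v : G} (hx : x ∈ P.X) (hy : y ∈ P.Y)
    (hy' : y' ∈ P.Y) (hmax : IsMaxOn (fun y => P.F x y z v) P.Y y)
    (hmax' : IsMaxOn (fun y => P.F x y z v) P.Y y') : y' = y := by
  have h1 := hP.F_growth_of_isMaxOn hx hy hy' hmax
  have h2 := hmax' hy
  simp only [mem_ofPred_eq] at h2
  have h3 := hP.r₂_sub_pos
  have h4 : ‖y' - y‖ ^ 2 ≤ 0 := by
    by_contra! h
    nlinarith
  exact sub_eq_zero.1 (norm_eq_zero.1 (by nlinarith [norm_nonneg (y' - y)]))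

/-- Adding the growth bounds at the two minimizers gives the Lipschitz constant `L / (r₁ - L)`,
which `r₁ ≥ 2L` makes at most 1. -/
theorem norm_xOf_sub_le {y y' : G} (hy : y ∈ P.Y) (hy' : y' ∈ P.Y) (z : E) (v : G) :
    ‖P.xOf y z v - P.xOf y' z v‖ ≤ ‖y - y'‖ := by
  have h1 := hP.F_xOf_growth (hP.xOf_mem y' z v) hy z v
  have h2 := hP.F_xOf_growth (hP.xOf_mem y z v) hy' z v
  have h3 := (abs_le.1
    (hP.abs_F_mixed_sub_le (hP.xOf_mem y z v) (hP.xOf_mem y' z v) hy hy' z v)).2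
  rw [norm_sub_rev (P.xOf y' z v)] at h1 h3
  have h4 : (P.r₁ - L) * ‖P.xOf y z v - P.xOf y' z v‖ ^ 2
      ≤ L * ‖y - y'‖ * ‖P.xOf y z v - P.xOf y' z v‖ := by linarith
  have h5 := hP.L_pos
  have h6 := hP.le_r₁
  by_contra! h
  have h7 : 0 < ‖P.xOf y z v - P.xOf y' z v‖ := (norm_nonneg _).trans_lt h
  have h8 : L * ‖y - y'‖ * ‖P.xOf y z v - P.xOf y' z v‖
      < L * ‖P.xOf y z v - P.xOf y' z v‖ * ‖P.xOf y z v - P.xOf y' z v‖ := by gcongr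
  nlinarith [mul_nonneg (show 0 ≤ P.r₁ - 2 * L by linarith)
    (sq_nonneg ‖P.xOf y z v - P.xOf y' z v‖)]

/-- `d` has a quadratic lower bound with curvature `L_d`. -/
theorem d_lower {y u : G} (hy : y ∈ P.Y) (hu : u ∈ P.Y) (z : E) (v : G) :
    P.d y z v + ⟪P.gradYF (P.xOf y z v) y z v, u - y⟫ - P.Ld L lam / 2 * ‖u - y‖ ^ 2
      ≤ P.d u z v := by
  rw [hP.d_eq, hP.d_eq]
  have hxu := hP.xOf_mem u z v
  have hxy := hP.xOf_mem y z v
  have h1 := hP.F_right_lower hxu hy hu z v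
  have h2 := hP.F_xOf_growth hxu hy z v
  have h3 := hP.norm_gradYF_sub_le hxu hxy hy z v
  have h4 : -(lam * L * ‖P.xOf u z v - P.xOf y z v‖ * ‖u - y‖)
      ≤ ⟪P.gradYF (P.xOf u z v) y z v, u - y⟫ - ⟪P.gradYF (P.xOf y z v) y z v, u - y⟫ := by
    rw [← inner_sub_left]
    have := abs_real_inner_le_norm
      (P.gradYF (P.xOf u z v) y z v - P.gradYF (P.xOf y z v) y z v) (u - y)
    linarith [(abs_le.1 this).1, mul_le_mul_of_nonneg_right h3 (norm_nonneg (u - y))]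
  have h5 := hP.r₁_sub_pos
  set D := ‖P.xOf u z v - P.xOf y z v‖
  set w := ‖u - y‖
  -- The growth of `F` in `x` pays for the shift `D` of the minimizer; completing the square in `D`
  -- produces the first term of `L_d`.
  have h6 : 0 ≤ (P.r₁ - L) / 2 * D ^ 2 - lam * L * D * w
      + lam * L / (P.r₁ - L) * (lam * L) / 2 * w ^ 2 := by
    have : (P.r₁ - L) / 2 * D ^ 2 - lam * L * D * w
      + lam * L / (P.r₁ - L) * (lam * L) / 2 * w ^ 2
      = ((P.r₁ - L) * D - lam * L * w) ^ 2 / (2 * (P.r₁ - L)) := by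
      field_simp
      ring
    rw [this]
    positivity
  have h7 : 0 ≤ lam * L * w ^ 2 := mul_nonneg hP.lamL_pos.le (sq_nonneg _)
  rw [Ld]
  nlinarith

/-- `d` has the same strongly concave upper bound as `F`. -/
theorem d_upper {y u : G} (hy : y ∈ P.Y) (hu : u ∈ P.Y) (z : E) (v : G) :
    P.d u z v ≤ P.d y z v + ⟪P.gradYF (P.xOf y z v) y z v, u - y⟫
      - (P.r₂ - lam * L) / 2 * ‖u - y‖ ^ 2 := by
  -- The old minimizer `x(y,z,v)` is a valid test point for `d u z v`.
  have hxy := hP.xOf_mem y z v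
  have h := hP.F_right_upper hxy hy hu z v
  rw [← hP.d_eq] at h
  exact (hP.d_le hxy u z v).trans h

end Regular
end Data

/-! ### Saddle points and their dependence on the proximal centres. -/

namespace Data

/-- `(x, y)` is a saddle point of `F(·, ·, z, v)` on `X × Y`. -/
structure IsSaddle (P : Data E G) (x : E) (y : G) (z : E) (v : G) : Prop where
  x_mem : x ∈ P.X
  y_mem : y ∈ P.Y
  isMinOn : IsMinOn (fun u => P.F u y z v) P.X x
  isMaxOn : IsMaxOn (fun u => P.F x u z v) P.Y y

namespace Regular

variable {P : Data E G} {L lam : ℝ} (hP : P.Regular L lam)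

include hP

theorem F_right_concave {x : E} {y y' : G} (hx : x ∈ P.X) (hy : y ∈ P.Y) (hy' : y' ∈ P.Y)
    (z : E) (v : G) {τ : ℝ} (hτ : τ ∈ Icc (0 : ℝ) 1) :
    (1 - τ) * P.F x y z v + τ * P.F x y' z v ≤ P.F x (y + τ • (y' - y)) z v := by
  have hw : y + τ • (y' - y) ∈ P.Y := hP.convex_Y.add_smul_sub_mem hy hy' hτ
  have h1 := hP.F_right_upper hx hw hy z v
  have h2 := hP.F_right_upper hx hw hy' z v
  set w := y + τ • (y' - y) with hw'
  have e1 : y - w = (-τ) • (y' - y) := by rw [hw']; module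
  have e2 : y' - w = (1 - τ) • (y' - y) := by rw [hw']; module
  have hs := hP.r₂_sub_pos
  have h1' : P.F x y z v ≤ P.F x w z v + ⟪P.gradYF x w z v, y - w⟫ := by
    have : 0 ≤ (P.r₂ - lam * L) / 2 * ‖y - w‖ ^ 2 := by positivity
    linarith
  have h2' : P.F x y' z v ≤ P.F x w z v + ⟪P.gradYF x w z v, y' - w⟫ := by
    have : 0 ≤ (P.r₂ - lam * L) / 2 * ‖y' - w‖ ^ 2 := by positivity
    linarith
  rw [e1, real_inner_smul_right] at h1'
  rw [e2, real_inner_smul_right] at h2'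
  nlinarith [mul_le_mul_of_nonneg_left h1' (sub_nonneg.2 hτ.2),
    mul_le_mul_of_nonneg_left h2' hτ.1]

/-- A direct minimax argument. At the minimizer for `y + τ(u - y)`, concavity in `y` and maximality
of `d` at `y` give `F(·, u) ≤ d(y)` after division by `τ`; letting `τ → 0` moves this minimizer to
`x(y,z,v)`. -/
theorem isSaddle_of_isMaxOn_d {y : G} {z : E} {v : G} (hy : y ∈ P.Y)
    (hmax : IsMaxOn (fun u => P.d u z v) P.Y y) : P.IsSaddle (P.xOf y z v) y z v := by
  refine ⟨hP.xOf_mem y z v, hy, hP.isMinOn_xOf y z v, fun u hu => ?_⟩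
  let γ : ℝ → G := fun τ => y + τ • (u - y)
  have hγ : ∀ τ ∈ Ioc (0 : ℝ) 1, γ τ ∈ P.Y := fun τ hτ =>
    hP.convex_Y.add_smul_sub_mem hy hu ⟨hτ.1.le, hτ.2⟩
  have hev : ∀ᶠ τ : ℝ in 𝓝[>] 0, τ ∈ Ioc (0 : ℝ) 1 :=
    Ioc_mem_nhdsGT one_pos
  have hbound : ∀ᶠ τ : ℝ in 𝓝[>] 0, P.F (P.xOf (γ τ) z v) u z v ≤ P.d y z v := by
    filter_upwards [hev] with τ hτ
    have h1 := hP.F_right_concave (hP.xOf_mem (γ τ) z v) hy hu z v ⟨hτ.1.le, hτ.2⟩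
    have h2 := hP.d_le (hP.xOf_mem (γ τ) z v) y z v
    have h3 : P.d (γ τ) z v ≤ P.d y z v := hmax (hγ τ hτ)
    rw [hP.d_eq (γ τ)] at h3
    have h4 := h1.trans h3
    have h5 := mul_le_mul_of_nonneg_left h2 (sub_nonneg.2 hτ.2)
    have h6 : τ * P.F (P.xOf (γ τ) z v) u z v ≤ τ * P.d y z v := by linarith
    exact le_of_mul_le_mul_left h6 hτ.1
  have hlim : Filter.Tendsto (fun τ : ℝ => P.xOf (γ τ) z v) (𝓝[>] 0) (𝓝 (P.xOf y z v)) := by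
    rw [tendsto_iff_norm_sub_tendsto_zero]
    have h0 : Filter.Tendsto (fun τ : ℝ => ‖γ τ - y‖) (𝓝[>] 0) (𝓝 0) := by
      have : Continuous fun τ : ℝ => ‖γ τ - y‖ := by fun_prop
      have := this.tendsto 0
      simp only [γ, zero_smul, add_zero, sub_self, norm_zero] at this
      exact this.mono_left nhdsWithin_le_nhds
    refine squeeze_zero' (Filter.Eventually.of_forall fun _ => norm_nonneg _) ?_ h0
    filter_upwards [hev] with τ hτ
    exact hP.norm_xOf_sub_le (hγ τ hτ) hy z v
  have := le_of_tendsto (((hP.continuous_F_left u z v).tendsto _).comp hlim) hbound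
  rwa [hP.d_eq] at this

theorem exists_isSaddle (z : E) (v : G) : ∃ x y, P.IsSaddle x y z v := by
  obtain ⟨y, hy, hmax⟩ := hP.compact_Y.exists_isMaxOn hP.nonempty_Y
    (hP.continuous_d_left z v).continuousOn
  exact ⟨_, y, hP.isSaddle_of_isMaxOn_d hy hmax⟩

end Regular

namespace IsSaddle

variable {P : Data E G} {L lam : ℝ} {x : E} {y : G} {z : E} {v : G}
  (hP : P.Regular L lam) (hs : P.IsSaddle x y z v)

include hP hs

theorem xOf_eq : P.xOf y z v = x := (hP.isMinOn_xOf_unique hs.x_mem hs.y_mem hs.isMinOn).symm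

theorem yOf_eq : P.yOf x z v = y :=
  hP.isMaxOn_F_unique hs.x_mem hs.y_mem (hP.yOf_mem x z v) hs.isMaxOn (hP.isMaxOn_yOf x z v)

theorem d_eq : P.d y z v = P.F x y z v := by rw [hP.d_eq, hs.xOf_eq hP]

theorem h_eq : P.h x z v = P.F x y z v := by rw [hP.h_eq, hs.yOf_eq hP]

theorem d_growth {u : G} (hu : u ∈ P.Y) :
    P.d u z v ≤ P.d y z v - (P.r₂ - lam * L) / 2 * ‖u - y‖ ^ 2 := by
  rw [hs.d_eq hP]
  exact (hP.d_le hs.x_mem u z v).trans (hP.F_growth_of_isMaxOn hs.x_mem hs.y_mem hu hs.isMaxOn)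

theorem h_growth {u : E} (hu : u ∈ P.X) :
    P.h x z v + (P.r₁ - L) / 2 * ‖u - x‖ ^ 2 ≤ P.h u z v := by
  rw [hs.h_eq hP]
  exact (hP.F_growth_of_isMinOn hs.x_mem hu hs.y_mem hs.isMinOn).trans (hP.le_h hs.y_mem u z v)

theorem isMaxOn_d : IsMaxOn (fun u => P.d u z v) P.Y y := fun u hu => by
  have := hs.d_growth hP hu
  have h3 := hP.r₂_sub_pos
  have : 0 ≤ (P.r₂ - lam * L) / 2 * ‖u - y‖ ^ 2 := by positivity
  simp only [mem_ofPred_eq]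
  linarith

theorem isMinOn_h : IsMinOn (fun u => P.h u z v) P.X x := fun u hu => by
  have := hs.h_growth hP hu
  have h3 := hP.r₁_sub_pos
  have : 0 ≤ (P.r₁ - L) / 2 * ‖u - x‖ ^ 2 := by positivity
  simp only [mem_ofPred_eq]
  linarith

theorem isMaxOn_d_unique {u : G} (hu : u ∈ P.Y) (hmax : IsMaxOn (fun u => P.d u z v) P.Y u) :
    u = y := by
  have h1 := hs.d_growth hP hu
  have h2 := hmax hs.y_mem
  simp only [mem_ofPred_eq] at h2
  have h3 := hP.r₂_sub_pos
  have h4 : ‖u - y‖ ^ 2 ≤ 0 := by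
    by_contra! h
    nlinarith
  exact sub_eq_zero.1 (norm_eq_zero.1 (by nlinarith [norm_nonneg (u - y)]))

theorem isMinOn_h_unique {u : E} (hu : u ∈ P.X) (hmin : IsMinOn (fun u => P.h u z v) P.X u) :
    u = x := by
  have h1 := hs.h_growth hP hu
  have h2 := hmin hs.x_mem
  simp only [mem_ofPred_eq] at h2
  have h3 := hP.r₁_sub_pos
  have h4 : ‖u - x‖ ^ 2 ≤ 0 := by
    by_contra! h
    nlinarith
  exact sub_eq_zero.1 (norm_eq_zero.1 (by nlinarith [norm_nonneg (u - x)]))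

theorem xStar_eq : P.xStar z v = x := by
  have := Classical.epsilon_spec (p := fun a => a ∈ P.X ∧ IsMinOn (fun u => P.h u z v) P.X a)
    ⟨x, hs.x_mem, hs.isMinOn_h hP⟩
  exact hs.isMinOn_h_unique hP this.1 this.2

theorem p_eq : P.p z v = P.d y z v := by
  refine IsGreatest.csSup_eq ⟨mem_image_of_mem _ hs.y_mem, ?_⟩
  rintro _ ⟨u, hu, rfl⟩
  exact hs.isMaxOn_d hP hu

theorem p_eq_h : P.p z v = P.h x z v := by
  rw [hs.p_eq hP, hs.d_eq hP, hs.h_eq hP]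

/-- Perturbation of saddle points in the proximal centres. -/
theorem perturbation {x' : E} {y' : G} {z' : E} {v' : G} (hs' : P.IsSaddle x' y' z' v') :
    (P.r₁ - L) * ‖x' - x‖ ^ 2 + (P.r₂ - lam * L) * ‖y' - y‖ ^ 2
      ≤ P.r₁ * ⟪x' - x, z' - z⟫ + P.r₂ * ⟪y' - y, v' - v⟫ := by
  have h1 := hP.F_growth_of_isMinOn hs.x_mem hs'.x_mem hs.y_mem hs.isMinOn
  have h2 := hP.F_growth_of_isMaxOn hs.x_mem hs.y_mem hs'.y_mem hs.isMaxOn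
  have h3 := hP.F_growth_of_isMinOn hs'.x_mem hs.x_mem hs'.y_mem hs'.isMinOn
  have h4 := hP.F_growth_of_isMaxOn hs'.x_mem hs'.y_mem hs.y_mem hs'.isMaxOn
  rw [norm_sub_rev x x'] at h3
  rw [norm_sub_rev y y'] at h4
  -- When the four growth bounds are added, all values of `f` cancel, leaving squared distances to
  -- the centres; polarization turns these into inner products.
  have ex : ⟪x' - x, z' - z⟫
      = (‖x' - z‖ ^ 2 - ‖x' - z'‖ ^ 2 - ‖x - z‖ ^ 2 + ‖x - z'‖ ^ 2) / 2 := by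
    simp only [norm_sub_sq_real, inner_sub_left, inner_sub_right]
    ring
  have ey : ⟪y' - y, v' - v⟫
      = (‖y' - v‖ ^ 2 - ‖y' - v'‖ ^ 2 - ‖y - v‖ ^ 2 + ‖y - v'‖ ^ 2) / 2 := by
    simp only [norm_sub_sq_real, inner_sub_left, inner_sub_right]
    ring
  rw [ex, ey]
  simp only [F] at h1 h2 h3 h4
  linarith

end IsSaddle

namespace Regular

variable {P : Data E G} {L lam : ℝ} (hP : P.Regular L lam)

include hP

theorem isSaddle_xStar (z : E) (v : G) :
    P.IsSaddle (P.xStar z v) (P.yOf (P.xStar z v) z v) z v := by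
  obtain ⟨x, y, hs⟩ := hP.exists_isSaddle z v
  rw [hs.xStar_eq hP, hs.yOf_eq hP]
  exact hs

/-- The centre `v` enters `F` through a term independent of `x`, so it does not affect the inner
minimization. -/
theorem d_eq_d_diag (y : G) (z : E) (v : G) :
    P.d y z v = P.d y z y - P.r₂ / 2 * ‖y - v‖ ^ 2 := by
  have h1 := hP.d_le (hP.xOf_mem y z y) y z v
  have h2 := hP.d_le (hP.xOf_mem y z v) y z y
  rw [hP.d_eq y z v] at h1 ⊢
  rw [hP.d_eq y z y] at h2 ⊢
  simp only [F, sub_self, norm_zero] at h1 h2 ⊢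
  linarith

/-- The set of all `v` is not compact, but the penalty in `d_eq_d_diag` vanishes at `v = y`. Hence a
maximizer of `d(y,z,y)` over the compact `Y` also maximizes `p(z,·)`. -/
theorem exists_isMaxOn_p (z : E) : ∃ v, IsMaxOn (fun u => P.p z u) univ v := by
  obtain ⟨y, hy, hmax⟩ := hP.compact_Y.exists_isMaxOn hP.nonempty_Y
    (hP.continuous_d_diag z).continuousOn
  refine ⟨y, fun v _ => ?_⟩
  have hs := hP.isSaddle_xStar z v
  have hs' := hP.isSaddle_xStar z y
  change P.p z v ≤ P.p z y
  rw [hs.p_eq hP, hs'.p_eq hP]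
  have h1 : P.d y z y ≤ P.d _ z y := hs'.isMaxOn_d hP hy
  have h2 : P.d _ z _ ≤ P.d y z y := hmax hs.y_mem
  have h3 := hP.d_eq_d_diag (P.yOf (P.xStar z v) z v) z v
  have h4 := hP.lamL_pos
  have h5 := hP.le_r₂
  have h6 : 0 ≤ P.r₂ / 2 * ‖P.yOf (P.xStar z v) z v - v‖ ^ 2 :=
    mul_nonneg (by linarith) (sq_nonneg _)
  linarith

omit [InnerProductSpace ℝ E] [CompleteSpace E] [InnerProductSpace ℝ G] [CompleteSpace G] hP in
theorem q_eq {z : E} {v : G} (hv : IsMaxOn (fun u => P.p z u) univ v) : P.q z = P.p z v := by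
  refine IsGreatest.csSup_eq ⟨mem_range_self v, ?_⟩
  rintro _ ⟨u, rfl⟩
  exact hv (mem_univ u)

theorem p_le_q (z : E) (v : G) : P.p z v ≤ P.q z := by
  obtain ⟨w, hw⟩ := hP.exists_isMaxOn_p z
  rw [q_eq hw]
  exact hw (mem_univ v)

/-- Increment of `q` along a change of the proximal centre. -/
theorem q_sub_q_ge {z z' : E} {v : G} (hv : IsMaxOn (fun u => P.p z' u) univ v) :
    P.r₁ / 2 * (‖P.xStar z v - z‖ ^ 2 - ‖P.xStar z v - z'‖ ^ 2) ≤ P.q z - P.q z' := by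
  have hs := hP.isSaddle_xStar z v
  have hs' := hP.isSaddle_xStar z' v
  have h1 := hP.p_le_q z v
  rw [q_eq hv, hs'.p_eq_h hP]
  -- Testing the problem at `z'` with the optimizer for `z` leaves only the difference of the two
  -- proximal terms at that point.
  have h2 : P.h (P.xStar z' v) z' v ≤ P.h (P.xStar z v) z' v := hs'.isMinOn_h hP hs.x_mem
  rw [hs.p_eq_h hP] at h1
  have h3 := hP.le_h (hP.yOf_mem (P.xStar z v) z' v) (P.xStar z v) z v
  rw [hP.h_eq (P.xStar z v) z' v] at h2
  simp only [F] at h2 h3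
  linarith

theorem d_sub_d_ge (y : G) (z z' : E) (v : G) :
    P.r₁ / 2 * (‖P.xOf y z' v - z'‖ ^ 2 - ‖P.xOf y z' v - z‖ ^ 2)
      ≤ P.d y z' v - P.d y z v := by
  have h1 := hP.d_le (hP.xOf_mem y z' v) y z v
  rw [hP.d_eq y z']
  simp only [F] at h1 ⊢
  linarith

theorem norm_xStar_sub_le (z z' : E) (v : G) : ‖P.xStar z v - P.xStar z' v‖ ≤ 2 * ‖z - z'‖ := by
  have h := (hP.isSaddle_xStar z' v).perturbation hP (hP.isSaddle_xStar z v)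
  rw [sub_self, inner_zero_right, mul_zero, add_zero] at h
  have h1 := real_inner_le_norm (P.xStar z v - P.xStar z' v) (z - z')
  have h2 := hP.r₂_sub_pos
  have h3 : 0 ≤ (P.r₂ - lam * L)
    * ‖P.yOf (P.xStar z v) z v - P.yOf (P.xStar z' v) z' v‖ ^ 2 := by positivity
  have h4 := hP.L_pos
  have h5 := hP.le_r₁
  set D := ‖P.xStar z v - P.xStar z' v‖
  by_contra! hlt
  have hD : 0 < D := (mul_nonneg zero_le_two (norm_nonneg _)).trans_lt hlt
  have h6 : P.r₁ * ⟪P.xStar z v - P.xStar z' v, z - z'⟫ ≤ P.r₁ * (D * ‖z - z'‖) :=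
    mul_le_mul_of_nonneg_left h1 (by linarith)
  have h7 : P.r₁ * (D * ‖z - z'‖) < P.r₁ * (D * (D / 2)) := by
    have : 0 < P.r₁ := by linarith
    gcongr
    linarith
  nlinarith [mul_nonneg (show 0 ≤ P.r₁ - 2 * L by linarith) (sq_nonneg D)]

theorem norm_xStar_sub_sq_le (z : E) (v v' : G) :
    P.r₁ * ‖P.xStar z v - P.xStar z v'‖ ^ 2 ≤ P.r₂ * ‖v - v'‖ ^ 2 := by
  have h := (hP.isSaddle_xStar z v').perturbation hP (hP.isSaddle_xStar z v)
  rw [sub_self, inner_zero_right, mul_zero, zero_add] at h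
  set Y := P.yOf (P.xStar z v) z v - P.yOf (P.xStar z v') z v'
  have h1 := real_inner_le_norm Y (v - v')
  have h2 : 0 < P.r₂ := by linarith [hP.lamL_pos, hP.r₂_sub_pos]
  have h3 := mul_le_mul_of_nonneg_left h1 h2.le
  have h4 : P.r₂ / 2 * ‖Y‖ ^ 2 ≤ (P.r₂ - lam * L) * ‖Y‖ ^ 2 := by
    gcongr; linarith [hP.le_r₂]
  have h5 : P.r₁ / 2 * ‖P.xStar z v - P.xStar z v'‖ ^ 2
      ≤ (P.r₁ - L) * ‖P.xStar z v - P.xStar z v'‖ ^ 2 := by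
    gcongr; linarith [hP.le_r₁]
  nlinarith [mul_nonneg h2.le (sq_nonneg (‖Y‖ - ‖v - v'‖))]

theorem norm_yOf_xStar_sub_sq_le (z z' : E) (v : G) :
    2 * (lam * L) * ‖P.yOf (P.xStar z v) z v - P.yOf (P.xStar z' v) z' v‖ ^ 2
      ≤ P.r₁ * ‖z - z'‖ ^ 2 := by
  have h := (hP.isSaddle_xStar z' v).perturbation hP (hP.isSaddle_xStar z v)
  rw [sub_self, inner_zero_right, mul_zero, add_zero] at h
  set Y := P.yOf (P.xStar z v) z v - P.yOf (P.xStar z' v) z' v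
  set D := P.xStar z v - P.xStar z' v
  have h1 := real_inner_le_norm D (z - z')
  have h2 : 0 < P.r₁ := by linarith [hP.L_pos, hP.r₁_sub_pos]
  have h3 := mul_le_mul_of_nonneg_left h1 h2.le
  have h4 : P.r₁ / 2 * ‖D‖ ^ 2 ≤ (P.r₁ - L) * ‖D‖ ^ 2 := by
    gcongr; linarith [hP.le_r₁]
  have h5 : lam * L * ‖Y‖ ^ 2 ≤ (P.r₂ - lam * L) * ‖Y‖ ^ 2 := by
    gcongr; linarith [hP.le_r₂]
  nlinarith [mul_nonneg h2.le (sq_nonneg (‖D‖ - ‖z - z'‖))]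

end Regular
end Data

/-! ### Absorption of the error terms. -/

/-- The scalar bookkeeping of the descent estimate. -/
theorem descent_arithmetic {r₁ r₂ l c α β μ a b ζ η T e D S A B W : ℝ}
    (hr₁ : 0 < r₁) (hr₂ : 0 < r₂) (hl : 0 < l) (hc : 0 < c) (hα : 0 < α) (hβ : 0 < β) (hμ : 0 < μ)
    (hc₁ : 3 * r₁ * c ≤ 4) (hc₂ : 6 * l * c ≤ 1) (hα₁ : 6 * r₂ * α ≤ 1) (hα₂ : 12 * (α * l) ≤ 1)
    (hβ₁ : 15 * β ≤ 1) (hβ₂ : 1920 * (r₁ * β) ≤ α * l ^ 2) (hμ₁ : 100 * μ ≤ 1)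
    (hμ₂ : 320 * (r₂ * μ) ≤ α * l ^ 2)
    (hT : T ^ 2 ≤ 2 * η ^ 2 + 2 * e ^ 2) (hS : r₁ * S ^ 2 ≤ r₂ * (μ * T) ^ 2)
    (he : e ^ 2 ≤ 3 * (A ^ 2 + B ^ 2 + W ^ 2)) (hA : A ^ 2 ≤ 2 / 3 * (α * l) * a ^ 2)
    (hB : (α * l) ^ 2 * B ^ 2 ≤ b ^ 2) (hW : 2 * l * W ^ 2 ≤ r₁ * (β * ζ) ^ 2) :
    r₁ / 32 * a ^ 2 + r₂ / 15 * b ^ 2 + r₁ / (5 * β) * (β * ζ) ^ 2 + r₂ / (4 * μ) * (μ * T) ^ 2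
        - 4 * r₁ * β * D ^ 2
      ≤ 4 / (27 * c) * a ^ 2 + b ^ 2 / (12 * α) + r₁ / 2 * (2 * β - β ^ 2) * ζ ^ 2
        + r₂ / 2 * (2 * μ - μ ^ 2) * η ^ 2 - 2 * r₁ * (β * ζ) * (2 * (β * ζ) + D + S + e) := by
  -- In the application, with `ys = y(x(z',v),z',v)`: `l = λL`, `a = ‖x'-x‖`, `b = ‖y-y₊‖`, `ζ =
  -- ‖x'-z‖`, `η = ‖y'-v‖`, `T = ‖ys-v‖`, `e = ‖ys-y'‖`. `D` and `S` are the distances from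
  -- `x(z',v₊)` to `x(z',v(z'))` and `x(z',v)`. `A`, `B`, `W` are the legs of the path from `y'` to
  -- `ys` through `y₊` and `y(x(z,v),z,v)`.
  have hrβ : 0 < r₁ * β := by positivity
  have hrμ : 0 < r₂ * μ := by positivity
  have hαl : 0 < α * l := by positivity
  have e1 : r₁ / (5 * β) * (β * ζ) ^ 2 = r₁ * β * ζ ^ 2 / 5 := by field_simp
  have e2 : r₂ / (4 * μ) * (μ * T) ^ 2 = r₂ * μ * T ^ 2 / 4 := by field_simp
  -- The Young weight makes the coefficient of `D ^ 2` exactly the one allowed in the conclusion.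
  have i1 : 2 * r₁ * (β * ζ) * D ≤ r₁ * β * ζ ^ 2 / 4 + 4 * r₁ * β * D ^ 2 := by
    linarith only [mul_nonneg hrβ.le (sq_nonneg (ζ / 2 - 2 * D))]
  have i2 : 2 * r₁ * (β * ζ) * S ≤ r₁ * β * ζ ^ 2 / 16 + 16 * β * (r₁ * S ^ 2) := by
    linarith only [mul_nonneg hrβ.le (sq_nonneg (ζ / 4 - 4 * S))]
  have i3 : 2 * r₁ * (β * ζ) * e ≤ r₁ * β * ζ ^ 2 / 16 + 16 * (r₁ * β) * e ^ 2 := by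
    linarith only [mul_nonneg hrβ.le (sq_nonneg (ζ / 4 - 4 * e))]
  have i4 : 16 * β * (r₁ * S ^ 2) ≤ r₂ * μ * T ^ 2 * (16 / 1500) := by
    have h1 : 16 * β * (r₁ * S ^ 2) ≤ 16 * β * (r₂ * (μ * T) ^ 2) := by gcongr
    have h2 : β * μ ≤ 1 / 15 * (1 / 100) := by
      apply mul_le_mul <;> linarith
    have h3 := mul_le_mul_of_nonneg_left h2 (show 0 ≤ r₂ * μ * T ^ 2 by positivity)
    linarith
  have i5 : r₂ * μ * (T ^ 2 * (199 / 400) - e ^ 2) ≤ r₂ / 2 * (2 * μ - μ ^ 2) * η ^ 2 := by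
    have h1 : r₂ * μ * (199 / 200) * η ^ 2 ≤ r₂ / 2 * (2 * μ - μ ^ 2) * η ^ 2 := by
      have : r₂ * μ * (199 / 200) ≤ r₂ / 2 * (2 * μ - μ ^ 2) := by
        linarith only [mul_le_mul_of_nonneg_left hμ₁ hrμ.le]
      gcongr
    have h2 := mul_le_mul_of_nonneg_left hT (show 0 ≤ r₂ * μ * (199 / 400) by positivity)
    linarith only [mul_nonneg hrμ.le (sq_nonneg e), h1, h2]
  have i6 : (r₂ * μ + 16 * (r₁ * β)) * e ^ 2
      ≤ 3 / 80 * (α * l ^ 2) * A ^ 2 + 3 / 80 * (α * l ^ 2) * B ^ 2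
        + 3 / 80 * (α * l ^ 2) * W ^ 2 := by
    -- The bounds `hμ₂` and `hβ₂` contribute `1/320 + 16/1920 = 11/960 < 1/80`.
    have h1 : r₂ * μ + 16 * (r₁ * β) ≤ α * l ^ 2 / 80 := by
      have : 0 < α * l ^ 2 := by positivity
      linarith
    calc (r₂ * μ + 16 * (r₁ * β)) * e ^ 2 ≤ α * l ^ 2 / 80 * (3 * (A ^ 2 + B ^ 2 + W ^ 2)) := by
          gcongr
      _ = _ := by ring
  have i7 : 3 / 80 * (α * l ^ 2) * A ^ 2 ≤ a ^ 2 / c / 34560 := by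
    have h1 : 3 / 80 * (α * l ^ 2) * A ^ 2 ≤ 3 / 80 * (α * l ^ 2) * (2 / 3 * (α * l) * a ^ 2) := by
      gcongr
    have h2 : (α * l) * (α * l) ≤ 1 / 12 * (1 / 12) := by
      apply mul_le_mul <;> linarith
    have h3 : l ≤ 1 / (6 * c) := by rw [le_div_iff₀ (by positivity)]; linarith
    have h4 : (α * l) * (α * l) * l ≤ 1 / 12 * (1 / 12) * (1 / (6 * c)) := by gcongr
    have h5 := mul_le_mul_of_nonneg_right h4 (sq_nonneg a)
    have e3 : 1 / 12 * (1 / 12) * (1 / (6 * c)) * a ^ 2 = a ^ 2 / c / 864 := by ring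
    rw [e3] at h5
    linarith
  have i8 : 3 / 80 * (α * l ^ 2) * B ^ 2 ≤ 3 / 80 * (b ^ 2 / α) := by
    have : α * l ^ 2 * B ^ 2 ≤ b ^ 2 / α := by
      rw [le_div_iff₀ hα]; linarith
    linarith
  have i9 : 3 / 80 * (α * l ^ 2) * W ^ 2 ≤ r₁ * β * ζ ^ 2 / 640 := by
    have h1 := mul_le_mul_of_nonneg_left hW hαl.le
    have h2 : α * l * (r₁ * (β * ζ) ^ 2) ≤ 1 / 12 * (r₁ * (β * ζ) ^ 2) := by
      gcongr; linarith
    have h3 : r₁ * (β * ζ) ^ 2 ≤ r₁ * β * ζ ^ 2 := by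
      have := mul_le_mul_of_nonneg_left (show β ≤ 1 by linarith)
        (show 0 ≤ r₁ * β * ζ ^ 2 by positivity)
      linarith
    linarith
  have i10 : r₁ * a ^ 2 ≤ 4 / 3 * (a ^ 2 / c) := by
    have h1 : r₁ ≤ 4 / 3 * (1 / c) := by
      rw [mul_one_div, le_div_iff₀ hc]; linarith
    have := mul_le_mul_of_nonneg_right h1 (sq_nonneg a)
    calc _ ≤ _ := this
      _ = _ := by ring
  have i11 : r₂ * b ^ 2 ≤ 1 / 6 * (b ^ 2 / α) := by
    have h1 : r₂ ≤ 1 / 6 * (1 / α) := by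
      rw [mul_one_div, le_div_iff₀ hα]; linarith
    have := mul_le_mul_of_nonneg_right h1 (sq_nonneg b)
    calc _ ≤ _ := this
      _ = _ := by ring
  have i12 : r₁ * β ^ 2 * ζ ^ 2 ≤ r₁ * β * ζ ^ 2 / 15 := by
    have := mul_le_mul_of_nonneg_left (show β ≤ 1 / 15 by linarith)
      (show 0 ≤ r₁ * β * ζ ^ 2 by positivity)
    linarith
  have e4 : 4 / (27 * c) * a ^ 2 = 4 / 27 * (a ^ 2 / c) := by field_simp
  have e5 : b ^ 2 / (12 * α) = 1 / 12 * (b ^ 2 / α) := by field_simp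
  rw [e1, e2, e4, e5]
  have n1 : 0 ≤ a ^ 2 / c := by positivity
  have n2 : 0 ≤ b ^ 2 / α := by positivity
  have n3 : 0 ≤ r₁ * β * ζ ^ 2 := by positivity
  have n4 : 0 ≤ r₂ * μ * T ^ 2 := by positivity
  linarith

/-! ### Decrease of the Lyapunov function in one iteration. -/

namespace Data.Regular

variable {P : Data E G} {L lam : ℝ} (hP : P.Regular L lam)

include hP

theorem F_sub_F_projected_step_ge {c : ℝ} (hc : 0 < c) (hc₁ : 3 * (L + P.r₁) * c ≤ 4)
    {x : E} {y : G} (hx : x ∈ P.X) (hy : y ∈ P.Y) (z : E) (v : G) :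
    1 / (3 * c) * ‖proj P.X (x - c • P.gradXF x y z v) - x‖ ^ 2
      ≤ P.F x y z v - P.F (proj P.X (x - c • P.gradXF x y z v)) y z v := by
  have h1 := inner_projected_step hP.compact_X hP.nonempty_X hP.convex_X x (P.gradXF x y z v) c hx
  have h2 := hP.F_left_upper hx
    (proj_mem hP.compact_X hP.nonempty_X (x - c • P.gradXF x y z v)) hy z v
  set x' := proj P.X (x - c • P.gradXF x y z v)
  rw [← neg_sub x' x, inner_neg_left, real_inner_self_eq_norm_sq] at h1
  have h3 := mul_le_mul_of_nonneg_left h2 hc.le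
  have h4 := mul_le_mul_of_nonneg_right hc₁ (sq_nonneg ‖x' - x‖)
  rw [one_div, inv_mul_le_iff₀ (by positivity)]
  linarith

theorem norm_projected_step_sub_xOf_le {c : ℝ} (hc : 0 < c) (hc₁ : 3 * (L + P.r₁) * c ≤ 4)
    {x : E} {y : G} (hx : x ∈ P.X) (hy : y ∈ P.Y) (z : E) (v : G) :
    ‖proj P.X (x - c • P.gradXF x y z v) - P.xOf y z v‖
      ≤ P.σ L c * ‖proj P.X (x - c • P.gradXF x y z v) - x‖ := by
  have hx' := proj_mem hP.compact_X hP.nonempty_X (x - c • P.gradXF x y z v)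
  have hs := hP.r₁_sub_pos
  have h := projected_step_error hP.compact_X hP.nonempty_X hP.convex_X (hP.xOf_mem y z v) hc hs
    (M := L + P.r₁) (by linarith) (hP.F_left_lower hx (hP.xOf_mem y z v) hy z v)
    (hP.F_left_upper hx hx' hy z v) (hP.F_xOf_growth hx' hy z v)
  refine h.trans ?_
  rw [σ, div_mul_eq_mul_div]
  gcongr
  have : 0 ≤ 2 * c * P.r₁ := by
    have := hP.L_pos
    have : 0 < P.r₁ := by linarith
    positivity
  nlinarith [norm_nonneg (proj P.X (x - c • P.gradXF x y z v) - x)]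

/-- `y₊` is a projected gradient step for `-d`, whose strong convexity modulus `r₂ - λL` is at least
`λL`. -/
theorem norm_yPlus_sub_le {α : ℝ} (hα : 0 < α) (hα₂ : 6 * P.Ld L lam * α ≤ 1)
    {y : G} (hy : y ∈ P.Y) (z : E) (v : G) :
    α * (lam * L) * ‖P.yPlus α y z v - P.yOf (P.xStar z v) z v‖ ≤ ‖P.yPlus α y z v - y‖ := by
  have hs := hP.isSaddle_xStar z v
  have e : P.yPlus α y z v = proj P.Y (y - α • -P.gradYF (P.xOf y z v) y z v) := by
    rw [yPlus, smul_neg, sub_neg_eq_add]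
  have hy' : P.yPlus α y z v ∈ P.Y := proj_mem hP.compact_Y hP.nonempty_Y _
  have h1 := hP.d_upper hy hs.y_mem z v
  have h2 := hP.d_lower hy hy' z v
  have h3 := hs.d_growth hP hy'
  rw [e] at h2 h3 ⊢
  have h := projected_step_error hP.compact_Y hP.nonempty_Y hP.convex_Y hs.y_mem hα hP.r₂_sub_pos
    (M := P.Ld L lam) (φx := -P.d y z v)
    (φp := -P.d (P.yOf (P.xStar z v) z v) z v) (g := -P.gradYF (P.xOf y z v) y z v) (x := y)
    (φw := -P.d (proj P.Y (y - α • -P.gradYF (P.xOf y z v) y z v)) z v)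
    (by linarith) (by rw [inner_neg_left]; linarith) (by rw [inner_neg_left]; linarith)
    (by linarith)
  have hs2 := hP.r₂_sub_pos
  rw [le_div_iff₀ (by positivity)] at h
  refine le_trans ?_ h
  rw [mul_comm]
  gcongr
  linarith [hP.le_r₂]

theorem norm_ascent_step_sub_yPlus_le {α : ℝ} (hα : 0 < α) {x : E} {y : G} (hx : x ∈ P.X)
    (hy : y ∈ P.Y) (z : E) (v : G) :
    ‖proj P.Y (y + α • P.gradYF x y z v) - P.yPlus α y z v‖
      ≤ α * (lam * L) * ‖x - P.xOf y z v‖ := by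
  refine (norm_proj_sub_proj_le hP.compact_Y hP.nonempty_Y hP.convex_Y _ _).trans ?_
  rw [add_sub_add_left_eq_sub, ← smul_sub, norm_smul, Real.norm_of_nonneg hα.le, mul_assoc]
  gcongr
  exact hP.norm_gradYF_sub_le hx (hP.xOf_mem y z v) hy z v

/-- Effect of one ascent step in `y` on `F - 2d`. -/
theorem ascent_step_ge {α : ℝ} (hα : 0 < α) {x : E} {y : G} (hx : x ∈ P.X)
    (hy : y ∈ P.Y) (z : E) (v : G) {y' : G} (hy' : y' = proj P.Y (y + α • P.gradYF x y z v)) :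
    (1 / α - P.Ld L lam) * ‖y' - y‖ ^ 2
        - 2 * (lam * L * ‖x - P.xOf y z v‖) * ‖y' - y‖
      ≤ P.F x y z v - P.F x y' z v + 2 * (P.d y' z v - P.d y z v) := by
  have hyY : y' ∈ P.Y := hy' ▸ proj_mem hP.compact_Y hP.nonempty_Y _
  have h1 := inner_projected_step hP.compact_Y hP.nonempty_Y hP.convex_Y y (-P.gradYF x y z v) α hy
  rw [smul_neg, sub_neg_eq_add, ← hy', inner_neg_left, ← neg_sub y' y, inner_neg_left,
    real_inner_self_eq_norm_sq] at h1
  have h1' : 1 / α * ‖y' - y‖ ^ 2 ≤ ⟪P.gradYF x y z v, y' - y⟫ := by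
    rw [one_div, inv_mul_le_iff₀ hα]; linarith
  have h2 := hP.F_right_upper hx hy hyY z v
  have h3 := hP.d_lower hy hyY z v
  have h4 := hP.norm_gradYF_sub_le hx (hP.xOf_mem y z v) hy z v
  have h5 := real_inner_le_norm (P.gradYF x y z v - P.gradYF (P.xOf y z v) y z v) (y' - y)
  rw [inner_sub_left] at h5
  have h6 := mul_le_mul_of_nonneg_right h4 (norm_nonneg (y' - y))
  have hs := hP.r₂_sub_pos
  have h7 : 0 ≤ (P.r₂ - lam * L) / 2 * ‖y' - y‖ ^ 2 := by positivity
  linarith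

theorem r₂_add_le_Ld : P.r₂ + 2 * (lam * L) ≤ P.Ld L lam := by
  have h1 := hP.r₁_sub_pos
  have h2 := hP.lamL_pos
  have : 0 ≤ lam * L / (P.r₁ - L) * (lam * L) := by positivity
  rw [Ld]
  linarith

/-- Decrease of `F - 2d` along the two projected gradient steps. -/
theorem gradient_steps_ge {c α : ℝ} (hc : 0 < c) (hc₁ : 3 * (L + P.r₁) * c ≤ 4)
    (hc₂ : 6 * (lam * L) * c ≤ 1) (hα : 0 < α) (hα₁ : 3 * (lam * L) * P.σ L c ^ 2 * α ≤ 2)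
    (hα₂ : 6 * P.Ld L lam * α ≤ 1) {x x' : E} {y y' : G} (hx : x ∈ P.X) (hy : y ∈ P.Y)
    {z : E} {v : G} (hx' : x' = proj P.X (x - c • P.gradXF x y z v))
    (hy' : y' = proj P.Y (y + α • P.gradYF x' y z v)) :
    4 / (27 * c) * ‖x' - x‖ ^ 2 + ‖y - P.yPlus α y z v‖ ^ 2 / (12 * α)
      ≤ P.F x y z v - P.F x' y' z v + 2 * (P.d y' z v - P.d y z v) := by
  have hxX : x' ∈ P.X := hx' ▸ proj_mem hP.compact_X hP.nonempty_X _
  have h1 := hP.F_sub_F_projected_step_ge hc hc₁ hx hy z v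
  have h2 := hP.norm_projected_step_sub_xOf_le hc hc₁ hx hy z v
  rw [← hx'] at h1 h2
  have h3 := hP.ascent_step_ge hα hxX hy z v hy'
  have h4 := hP.norm_ascent_step_sub_yPlus_le hα hxX hy z v
  rw [← hy'] at h4
  have h5 := norm_sub_le_norm_sub_add_norm_sub y y' (P.yPlus α y z v)
  rw [norm_sub_rev y y'] at h5
  have hl := hP.lamL_pos
  set l := lam * L
  set σ := P.σ L c
  set a := ‖x' - x‖
  set E₀ := ‖x' - P.xOf y z v‖
  set w := ‖y' - y‖
  set b := ‖y - P.yPlus α y z v‖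
  set A := ‖y' - P.yPlus α y z v‖
  have hE : 0 ≤ E₀ := norm_nonneg _
  have hw : 0 ≤ w := norm_nonneg _
  have hA : 0 ≤ A := norm_nonneg _
  have hb : 0 ≤ b := norm_nonneg _
  have hE2 : E₀ ^ 2 ≤ σ ^ 2 * a ^ 2 := by
    rw [← mul_pow]; exact pow_le_pow_left₀ hE h2 2
  have hlE : α * l * E₀ ^ 2 ≤ 2 / 3 * a ^ 2 := by
    have := mul_le_mul_of_nonneg_left hE2 (mul_pos hα hl).le
    have := mul_le_mul_of_nonneg_right hα₁ (sq_nonneg a)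
    linarith
  -- Of the `w ^ 2 / α` earned, `1/6` goes to `L_d`, `2/3` here, and the last `1/6` to `b`. For `a ^
  -- 2 / c` the balance is `1/3 - (1 + 1/9) / 6 = 4/27`.
  have hcross : 2 * (l * E₀) * w ≤ l * a ^ 2 + 2 / (3 * α) * w ^ 2 := by
    have e1 : 2 * (l * E₀) * w ≤ 3 / 2 * α * l ^ 2 * E₀ ^ 2 + 2 / (3 * α) * w ^ 2 := by
      have : 3 / 2 * α * l ^ 2 * E₀ ^ 2 + 2 / (3 * α) * w ^ 2 - 2 * (l * E₀) * w
          = (3 * α * l * E₀ - 2 * w) ^ 2 / (6 * α) := by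
        field_simp; ring
      have : 0 ≤ (3 * α * l * E₀ - 2 * w) ^ 2 / (6 * α) := by positivity
      linarith
    have := mul_le_mul_of_nonneg_left hlE hl.le
    linarith
  have hLd : P.Ld L lam ≤ 1 / (6 * α) := by
    rw [le_div_iff₀ (by positivity)]; linarith
  have hLdw := mul_le_mul_of_nonneg_right hLd (sq_nonneg w)
  have hlc : l ≤ 1 / (6 * c) := by
    rw [le_div_iff₀ (by positivity)]; linarith
  have hla := mul_le_mul_of_nonneg_right hlc (sq_nonneg a)
  have hA2 : A ^ 2 ≤ α * l * (2 / 3 * a ^ 2) := by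
    calc A ^ 2 ≤ (α * l * E₀) ^ 2 := pow_le_pow_left₀ hA h4 2
      _ = α * l * (α * l * E₀ ^ 2) := by ring
      _ ≤ _ := by gcongr
  have hb2 : b ^ 2 ≤ 2 * w ^ 2 + 2 * A ^ 2 := by
    nlinarith [pow_le_pow_left₀ hb h5 2, sq_nonneg (w - A)]
  have hb3 : b ^ 2 / (12 * α) ≤ 1 / (6 * α) * w ^ 2 + l * a ^ 2 / 9 := by
    calc b ^ 2 / (12 * α) ≤ (2 * w ^ 2 + 2 * (α * l * (2 / 3 * a ^ 2))) / (12 * α) := by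
          gcongr; linarith
      _ = _ := by field_simp; ring
  have e2 : 4 / (27 * c) * a ^ 2 = 4 / 27 * (a ^ 2 / c) := by field_simp
  have e3 : 1 / (3 * c) * a ^ 2 = 1 / 3 * (a ^ 2 / c) := by field_simp
  have e4 : 1 / (6 * c) * a ^ 2 = 1 / 6 * (a ^ 2 / c) := by field_simp
  have e5 : 1 / (6 * α) * w ^ 2 = 1 / 6 * (w ^ 2 / α) := by field_simp
  have e6 : 2 / (3 * α) * w ^ 2 = 2 / 3 * (w ^ 2 / α) := by field_simp
  have e7 : (1 / α - P.Ld L lam) * w ^ 2 = w ^ 2 / α - P.Ld L lam * w ^ 2 := by ring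
  rw [e2]
  rw [e3] at h1
  rw [e4] at hla
  rw [e5] at hLdw hb3
  rw [e6] at hcross
  rw [e7] at h3
  linarith

/-- One step of doubly smoothed gradient descent ascent decreases `Φ`. -/
theorem descent {c α β μ : ℝ} (hc : 0 < c) (hc₁ : 3 * (L + P.r₁) * c ≤ 4)
    (hc₂ : 6 * (lam * L) * c ≤ 1) (hα : 0 < α) (hα₁ : 3 * (lam * L) * P.σ L c ^ 2 * α ≤ 2)
    (hα₂ : 6 * P.Ld L lam * α ≤ 1) (hβ : 0 < β) (hβ₁ : 15 * β ≤ 1)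
    (hβ₂ : 1920 * (P.r₁ * β) ≤ α * (lam * L) ^ 2) (hμ : 0 < μ)
    (hμ₂ : 320 * (P.r₂ * μ) ≤ α * (lam * L) ^ 2) {x x' z z' : E} {y y' v v' : G}
    (hx : x ∈ P.X) (hy : y ∈ P.Y) (hx' : x' = proj P.X (x - c • P.gradXF x y z v))
    (hy' : y' = proj P.Y (y + α • P.gradYF x' y z v)) (hz' : z' = z + β • (x' - z))
    (hv' : v' = v + μ • (y' - v)) {vz : G} (hvz : IsMaxOn (fun u => P.p z' u) univ vz) :
    P.r₁ / 32 * ‖x' - x‖ ^ 2 + P.r₂ / 15 * ‖y - P.yPlus α y z v‖ ^ 2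
        + P.r₁ / (5 * β) * ‖z - z'‖ ^ 2 + P.r₂ / (4 * μ) * ‖P.vPlus μ v z' - v‖ ^ 2
        - 4 * P.r₁ * β * ‖P.xStar z' vz - P.xStar z' (P.vPlus μ v z')‖ ^ 2
      ≤ P.Φ x y z v - P.Φ x' y' z' v' := by
  have hL := hP.L_pos
  have hl := hP.lamL_pos
  have hr₁ : 0 < P.r₁ := by linarith [hP.le_r₁]
  have hr₂ : 0 < P.r₂ := by linarith [hP.le_r₂]
  have hLd := mul_le_mul_of_nonneg_right hP.r₂_add_le_Ld hα.le
  have hαl : 0 < α * (lam * L) := mul_pos hα hl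
  have hαr : 0 < α * P.r₂ := mul_pos hα hr₂
  have hαl₂ : 12 * (α * (lam * L)) ≤ 1 := by linarith
  have hμ₁ : 100 * μ ≤ 1 := by
    have h1 : α * (lam * L) ^ 2 ≤ 1 / 12 * (lam * L) := by
      have := mul_le_mul_of_nonneg_right hαl₂ hl.le
      linarith
    have h2 : 2 * (lam * L) * μ ≤ P.r₂ * μ := by
      gcongr; linarith [hP.le_r₂]
    have h3 : μ * (lam * L) ≤ 1 / 100 * (lam * L) := by linarith
    linarith [le_of_mul_le_mul_right h3 hl]
  have hxX : x' ∈ P.X := hx' ▸ proj_mem hP.compact_X hP.nonempty_X _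
  have hyY : y' ∈ P.Y := hy' ▸ proj_mem hP.compact_Y hP.nonempty_Y _
  have hsteps := hP.gradient_steps_ge hc hc₁ hc₂ hα hα₁ hα₂ hx hy hx' hy'
  -- the auxiliary dual optimum at the new centre `z'`
  set ys := P.yOf (P.xStar z' v) z' v with hys
  have hsad := hP.isSaddle_xStar z' v
  have hσ := hP.norm_projected_step_sub_xOf_le hc hc₁ hx hy z v
  rw [← hx'] at hσ
  have hA := hP.norm_ascent_step_sub_yPlus_le hα hxX hy z v
  rw [← hy'] at hA
  have hB := hP.norm_yPlus_sub_le hα hα₂ hy z v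
  have hW := hP.norm_yOf_xStar_sub_sq_le z z' v
  have hwz : ‖z - z'‖ = β * ‖x' - z‖ := by
    rw [hz', sub_add_cancel_left, norm_neg, norm_smul, Real.norm_of_nonneg hβ.le]
  have hgv : ‖P.vPlus μ v z' - v‖ = μ * ‖ys - v‖ := by
    rw [vPlus, add_sub_cancel_left, norm_smul, Real.norm_of_nonneg hμ.le]
  have hS := hP.norm_xStar_sub_sq_le z' (P.vPlus μ v z') v
  rw [hgv] at hS
  have hT : ‖ys - v‖ ≤ ‖y' - v‖ + ‖ys - y'‖ := by
    linarith [norm_sub_le_norm_sub_add_norm_sub ys y' v]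
  have he : ‖ys - y'‖ ≤ ‖y' - P.yPlus α y z v‖
      + ‖P.yPlus α y z v - P.yOf (P.xStar z v) z v‖ + ‖P.yOf (P.xStar z v) z v - ys‖ := by
    rw [norm_sub_rev ys y']
    linarith [norm_sub_le_norm_sub_add_norm_sub y' (P.yPlus α y z v) ys,
      norm_sub_le_norm_sub_add_norm_sub (P.yPlus α y z v) (P.yOf (P.xStar z v) z v) ys]
  have hxx : ‖P.xStar z vz - P.xOf y' z' v‖ ≤ 2 * ‖z - z'‖
      + ‖P.xStar z' vz - P.xStar z' (P.vPlus μ v z')‖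
      + ‖P.xStar z' (P.vPlus μ v z') - P.xStar z' v‖ + ‖ys - y'‖ := by
    have h1 := hP.norm_xStar_sub_le z z' vz
    have h2 := hP.norm_xOf_sub_le hsad.y_mem hyY z' v
    rw [hsad.xOf_eq hP] at h2
    linarith [norm_sub_le_norm_sub_add_norm_sub (P.xStar z vz) (P.xStar z' vz) (P.xOf y' z' v),
      norm_sub_le_norm_sub_add_norm_sub (P.xStar z' vz) (P.xStar z' (P.vPlus μ v z'))
        (P.xOf y' z' v),
      norm_sub_le_norm_sub_add_norm_sub (P.xStar z' (P.vPlus μ v z')) (P.xStar z' v)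
        (P.xOf y' z' v)]
  -- Each increment is bounded by the same difference of squared distances to `z` and `z'`, at two
  -- points and with opposite signs. The sum is therefore linear in the displacement between those
  -- points.
  have hdq : -(2 * P.r₁ * ‖z - z'‖ * ‖P.xStar z vz - P.xOf y' z' v‖)
      ≤ 2 * (P.d y' z' v - P.d y' z v) + 2 * (P.q z - P.q z') := by
    have h1 := hP.d_sub_d_ge y' z z' v
    have h2 := hP.q_sub_q_ge (z := z) hvz
    have h3 := real_inner_le_norm (z - z') (P.xStar z vz - P.xOf y' z' v)
    have h4 : ⟪z - z', P.xStar z vz - P.xOf y' z' v⟫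
        = -(‖P.xOf y' z' v - z'‖ ^ 2 - ‖P.xOf y' z' v - z‖ ^ 2
          + (‖P.xStar z vz - z‖ ^ 2 - ‖P.xStar z vz - z'‖ ^ 2)) / 2 := by
      simp only [norm_sub_sq_real, inner_sub_left, inner_sub_right,
        real_inner_comm z, real_inner_comm z']
      ring
    have h5 := mul_le_mul_of_nonneg_left h3 hr₁.le
    rw [h4] at h5
    linarith
  have hFzv : P.F x' y' z v - P.F x' y' z' v'
      = P.r₁ / 2 * (2 * β - β ^ 2) * ‖x' - z‖ ^ 2 - P.r₂ / 2 * (2 * μ - μ ^ 2) * ‖y' - v‖ ^ 2 := by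
    have e1 : ‖x' - z'‖ ^ 2 = (1 - β) ^ 2 * ‖x' - z‖ ^ 2 := by
      rw [hz', show x' - (z + β • (x' - z)) = (1 - β) • (x' - z) by module, norm_smul, mul_pow,
        Real.norm_eq_abs, sq_abs]
    have e2 : ‖y' - v'‖ ^ 2 = (1 - μ) ^ 2 * ‖y' - v‖ ^ 2 := by
      rw [hv', show y' - (v + μ • (y' - v)) = (1 - μ) • (y' - v) by module, norm_smul, mul_pow,
        Real.norm_eq_abs, sq_abs]
    rw [F, F, e1, e2]
    ring
  have hdv : P.d y' z' v' - P.d y' z' v = P.r₂ / 2 * (2 * μ - μ ^ 2) * ‖y' - v‖ ^ 2 := by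
    have e2 : ‖y' - v'‖ ^ 2 = (1 - μ) ^ 2 * ‖y' - v‖ ^ 2 := by
      rw [hv', show y' - (v + μ • (y' - v)) = (1 - μ) • (y' - v) by module, norm_smul, mul_pow,
        Real.norm_eq_abs, sq_abs]
    rw [hP.d_eq_d_diag y' z' v', hP.d_eq_d_diag y' z' v, e2]
    ring
  rw [hwz] at hW hxx hdq ⊢
  rw [hgv]
  have hA2 : ‖y' - P.yPlus α y z v‖ ^ 2 ≤ 2 / 3 * (α * (lam * L)) * ‖x' - x‖ ^ 2 := by
    calc _ ≤ (α * (lam * L) * (P.σ L c * ‖x' - x‖)) ^ 2 := by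
          gcongr; exact hA.trans (by gcongr)
      _ = α * (lam * L) * ‖x' - x‖ ^ 2 / 3 * (3 * (lam * L) * P.σ L c ^ 2 * α) := by ring
      _ ≤ α * (lam * L) * ‖x' - x‖ ^ 2 / 3 * 2 := by gcongr
      _ = _ := by ring
  have hB2 := pow_le_pow_left₀ (by positivity) hB 2
  rw [mul_pow, norm_sub_rev _ y] at hB2
  have hT2 : ‖ys - v‖ ^ 2 ≤ 2 * ‖y' - v‖ ^ 2 + 2 * ‖ys - y'‖ ^ 2 := by
    linarith only [pow_le_pow_left₀ (norm_nonneg _) hT 2, sq_nonneg (‖y' - v‖ - ‖ys - y'‖)]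
  have he2 : ‖ys - y'‖ ^ 2 ≤ 3 * (‖y' - P.yPlus α y z v‖ ^ 2
      + ‖P.yPlus α y z v - P.yOf (P.xStar z v) z v‖ ^ 2
      + ‖P.yOf (P.xStar z v) z v - ys‖ ^ 2) := by
    have := pow_le_pow_left₀ (norm_nonneg _) he 2
    set A := ‖y' - P.yPlus α y z v‖
    set B := ‖P.yPlus α y z v - P.yOf (P.xStar z v) z v‖
    set W := ‖P.yOf (P.xStar z v) z v - ys‖
    linarith only [this, sq_nonneg (A - B), sq_nonneg (B - W), sq_nonneg (A - W)]
  have hfinal := descent_arithmetic (D := ‖P.xStar z' vz - P.xStar z' (P.vPlus μ v z')‖) hr₁ hr₂ hl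
    hc hα hβ hμ (by linarith only [hc₁, mul_pos hL hc]) hc₂ (by linarith only [hα₂, hLd, hαl]) hαl₂ hβ₁ hβ₂ hμ₁ hμ₂ hT2 hS he2 hA2 hB2 hW
  have hprod := mul_le_mul_of_nonneg_left hxx
    (show 0 ≤ 2 * P.r₁ * (β * ‖x' - z‖) by positivity)
  simp only [Φ]
  linarith only [hfinal, hprod, hdq, hFzv, hdv, hsteps]

end Data.Regular

end DSGDA

/-! ### The main theorem: reduction to the one-step estimate. -/

theorem proposition1 {n m : ℕ}
    (P : DSGDA.Data (EuclideanSpace ℝ (Fin n)) (EuclideanSpace ℝ (Fin m)))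
    (hXc : IsCompact P.X) (hXconv : Convex ℝ P.X)
    (hYc : IsCompact P.Y) (hYconv : Convex ℝ P.Y)
    (L lam : ℝ) (hL : 0 < L) (hlam : 0 < lam)
    (hf : P.SmoothObjective L lam)
    (hr₁ : 2 * L ≤ P.r₁) (hr₂ : 2 * lam * L ≤ P.r₂)
    (c α β μ : ℝ)
    (hc : 0 < c) (hc' : c ≤ min (4 / (3 * (L + P.r₁))) (1 / (6 * lam * L)))
    (hα : 0 < α)
    (hα' : α ≤ min (min (2 / (3 * lam * L * (P.σ L c) ^ 2)) (1 / (6 * P.Ld L lam)))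
      (1 / (5 * lam * √(lam + 5) * L)))
    (hβ : 0 < β)
    (hβ' : β ≤ min
      (24 * P.r₁ / (360 * P.r₁ + 5 * P.r₁ ^ 2 * lam + (2 * lam * L + 5 * P.r₁) ^ 2))
      (α * lam ^ 2 * L ^ 2 / (384 * P.r₁ * (lam + 5) * (lam + 1) ^ 2)))
    (hμ : 0 < μ)
    (hμ' : μ ≤ min (2 * (lam + 5) / (2 * (lam + 5) + lam ^ 2 * L ^ 2))
      (α * lam ^ 2 * L ^ 2 / (64 * P.r₂ * (lam + 5))))
    (x : ℕ → EuclideanSpace ℝ (Fin n)) (y : ℕ → EuclideanSpace ℝ (Fin m))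
    (z : ℕ → EuclideanSpace ℝ (Fin n)) (v : ℕ → EuclideanSpace ℝ (Fin m))
    (halg : P.IsDSGDA c α β μ x y z v) :
    -- the minimizers and maximizers that enter the estimate are well defined
    (∀ y' ∈ P.Y, ∀ z' v', ∃! x', x' ∈ P.X ∧ IsMinOn (fun u => P.F u y' z' v') P.X x') ∧
    (∀ x' ∈ P.X, ∀ z' v', ∃! y', y' ∈ P.Y ∧ IsMaxOn (fun u => P.F x' u z' v') P.Y y') ∧
    (∀ z' v', ∃! y', y' ∈ P.Y ∧ IsMaxOn (fun u => P.d u z' v') P.Y y') ∧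
    (∀ z' v', ∃! x', x' ∈ P.X ∧ IsMinOn (fun u => P.h u z' v') P.X x') ∧
    (∀ z', ∃ v', IsMaxOn (fun u => P.p z' u) Set.univ v') ∧
    -- the descent estimate, for every maximizer `vz = v(z^{t+1})` of `p(z^{t+1}, ·)`
    ∀ t : ℕ, ∀ vz : EuclideanSpace ℝ (Fin m),
      IsMaxOn (fun u => P.p (z (t + 1)) u) Set.univ vz →
      P.r₁ / 32 * ‖x (t + 1) - x t‖ ^ 2
        + P.r₂ / 15 * ‖y t - P.yPlus α (y t) (z t) (v t)‖ ^ 2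
        + P.r₁ / (5 * β) * ‖z t - z (t + 1)‖ ^ 2
        + P.r₂ / (4 * μ) * ‖P.vPlus μ (v t) (z (t + 1)) - v t‖ ^ 2
        - 4 * P.r₁ * β * ‖P.xStar (z (t + 1)) vz
            - P.xStar (z (t + 1)) (P.vPlus μ (v t) (z (t + 1)))‖ ^ 2
      ≤ P.Φ (x t) (y t) (z t) (v t)
          - P.Φ (x (t + 1)) (y (t + 1)) (z (t + 1)) (v (t + 1)) := by
  have hX : P.X.Nonempty := ⟨_, halg.x_zero⟩
  have hY : P.Y.Nonempty := ⟨_, halg.y_zero⟩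
  have hP : P.Regular L lam :=
    ⟨hXc, hXconv, hX, hYc, hYconv, hY, hL, hlam, hf, hr₁, hr₂⟩
  refine ⟨fun y' hy' z' v' => ⟨P.xOf y' z' v', ⟨hP.xOf_mem _ _ _, hP.isMinOn_xOf _ _ _⟩,
      fun u hu => hP.isMinOn_xOf_unique hu.1 hy' hu.2⟩,
    fun x' hx' z' v' => ⟨P.yOf x' z' v', ⟨hP.yOf_mem _ _ _, hP.isMaxOn_yOf _ _ _⟩,
      fun u hu => hP.isMaxOn_F_unique hx' (hP.yOf_mem _ _ _) hu.1 (hP.isMaxOn_yOf _ _ _) hu.2⟩,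
    fun z' v' => ?_, fun z' v' => ?_, hP.exists_isMaxOn_p, fun t vz hvz => ?_⟩
  · have hs := hP.isSaddle_xStar z' v'
    exact ⟨_, ⟨hs.y_mem, hs.isMaxOn_d hP⟩, fun u hu => hs.isMaxOn_d_unique hP hu.1 hu.2⟩
  · have hs := hP.isSaddle_xStar z' v'
    exact ⟨_, ⟨hs.x_mem, hs.isMinOn_h hP⟩, fun u hu => hs.isMinOn_h_unique hP hu.1 hu.2⟩
  have hx : ∀ t, x t ∈ P.X := fun t => by
    cases t with
    | zero => exact halg.x_zero
    | succ t => exact halg.x_succ t ▸ DSGDA.proj_mem hXc hX _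
  have hy : ∀ t, y t ∈ P.Y := fun t => by
    cases t with
    | zero => exact halg.y_zero
    | succ t => exact halg.y_succ t ▸ DSGDA.proj_mem hYc hY _
  have hl := hP.lamL_pos
  have hs₁ := hP.r₁_sub_pos
  have hr₁p : 0 < P.r₁ := by linarith
  have hr₂p : 0 < P.r₂ := by linarith
  have hσ : 0 < P.σ L c := by
    unfold DSGDA.Data.σ
    positivity
  have hLd : 0 < P.Ld L lam := by linarith [hP.r₂_add_le_Ld]
  obtain ⟨hc₁, hc₂⟩ := le_min_iff.1 hc'
  obtain ⟨hα₁, hα₂⟩ := le_min_iff.1 (le_min_iff.1 hα').1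
  obtain ⟨hβ₁, hβ₂⟩ := le_min_iff.1 hβ'
  have hμ₂ := (le_min_iff.1 hμ').2
  rw [le_div_iff₀ (by positivity)] at hc₁ hc₂ hα₁ hα₂ hβ₁ hβ₂ hμ₂
  have hβ₁' : 15 * β ≤ 1 := by
    have h1 : 0 ≤ β * (5 * P.r₁ ^ 2 * lam + (2 * lam * L + 5 * P.r₁) ^ 2) := by positivity
    have h2 : 15 * β * P.r₁ ≤ 1 * P.r₁ := by linarith
    exact le_of_mul_le_mul_right h2 hr₁p
  have hβ₂' : 1920 * (P.r₁ * β) ≤ α * (lam * L) ^ 2 := by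
    -- The constant 1920 is `384 * 5`; likewise 320 below is `64 * 5`, from `lam + 5 ≥ 5`.
    have h1 : 5 * 1 ≤ (lam + 5) * (lam + 1) ^ 2 :=
      mul_le_mul (by linarith) (one_le_pow₀ (by linarith)) zero_le_one (by linarith)
    have h2 := mul_le_mul_of_nonneg_left h1 (show 0 ≤ 384 * (P.r₁ * β) by positivity)
    linarith
  have hμ₂' : 320 * (P.r₂ * μ) ≤ α * (lam * L) ^ 2 := by
    have h2 : 0 ≤ P.r₂ * μ * lam := by positivity
    linarith
  exact hP.descent hc (by linarith) (by linarith) hα (by linarith) (by linarith) hβ hβ₁' hβ₂' hμ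
    hμ₂' (hx t) (hy t) (halg.x_succ t) (halg.y_succ t) (halg.z_succ t) (halg.v_succ t) hvz
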